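/- Setting. Let $H$ be a complex Hilbert space and $\mathcal B\subseteq B(H)$ a von Neumann algebra. For $t\in\mathbb R_+$ let $\mathcal B_{t]}\subseteq\mathcal B$ be an increasing family of von Neumann algebras generating $\mathcal B$, let $\mathcal B_{[t}\subseteq\mathcal B$ and $\mathcal A_t\subseteq\mathcal B_{[t}$ be decreasing families of von Neumann algebras, and let $\mathcal B_{t]}$ commute with $\mathcal A_t$. Let $(\Omega,\mathfrak A)$ be a measurable space with an increasing family of sub-$\sigma$-algebras $\mathfrak A_{t]}$ (histories) and a decreasing family $\mathfrak A_t$ (future events); put $\mathfrak A_t^s=\mathfrak A_t\cap\mathfrak A_{t+s]}$ and suppose that $\mathfrak A_t$ is generated by the $\mathfrak A_t^s$, $s>0$. Let $E$ be a $\sigma$-homomorphism of $\mathfrak A$ into the orthoprojectors of $\mathcal B$ with $E(\mathfrak A_{t]})\subseteq\mathcal B_{t]}\cap\mathcal B_{[t}'$ and $E(\mathfrak A_t)\subseteq\mathcal B_{[t}$. Let $\mathcal M_{t]}$, $\mathcal M_t$ be the von Neumann algebras generated by $E(\mathfrak A_{t]})$, $E(\mathfrak A_t)$, and put $\mathcal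 A_t^s=\mathcal A_t\cap\mathcal B_{t+s]}$, $\mathcal M_t^s=\mathcal M_t\cap\mathcal M_{t+s]}$. Suppose that these form W*-product systems: for all $t\ge 0$, $s>0$ the map $x\otimes y\mapsto xy$ extends to W*-isomorphisms $\mathcal B_{t]}\bar\otimes\mathcal A_t^s\cong\mathcal B_{t+s]}$, $\mathcal M_{t]}\bar\otimes\mathcal M_t^s\cong\mathcal M_{t+s]}$ and (the case $s=\infty$) $\mathcal B_{t]}\bar\otimes\mathcal A_t\cong\mathcal B$. Let $\mathfrak b_t\subseteq\mathcal B_{t]}\cap\mathcal B_{[t}$ be von Neumann algebras, $\mathfrak b(t)$ von Neumann algebras on Hilbert spaces $K_t$, and let $\pi_t:\mathfrak b(t)\to\mathfrak b_t$ and $\pi^t:\mathfrak b_t\to\mathfrak b(t)$ be normal unital $*$-homomorphisms with $\pi_t\circ\pi^t=\mathrm{id}$. Suppose that the object is dynamical: $\mathcal M_t^s\vee\mathfrak b_{t+s}\subseteq\mathfrak b_t\vee\mathcal A_t^s$ for all $t\ge0$, $s>0$. Theorem. The representations $\pi_t$ extend to normal unital $*$-homomorphisms $\pi_t:\mathfrak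 b(t)\bar\otimes\mathcal A_t\to\mathfrak b_t\vee\mathcal A_t$ with $\pi_t(q\otimes a)=\pi_t(q)a$, and there exist maps $E^t:\mathfrak A_t\to\mathfrak b(t)\bar\otimes\mathcal A_t$ and normal unital $*$-homomorphisms $\gamma_r^t:\mathfrak b(t+r)\bar\otimes\mathcal A_{t+r}\to\mathfrak b(t)\bar\otimes\mathcal A_t$ ($t,r\ge0$) such that: 1. each $E^t$ is a $\sigma$-homomorphism into orthoprojectors, adapted in the sense that $E^t(\mathfrak A_t^s)\subseteq\mathfrak b(t)\bar\otimes\mathcal A_t^s$ for $s>0$; 2. $\gamma_r^t(1\otimes a)=1\otimes a$ for $a\in\mathcal A_{t+r}$ and, for $r>0$, $\gamma_r^t(\mathfrak b(t+r)\otimes 1)\subseteq\mathfrak b(t)\bar\otimes\mathcal A_t^r$ and all values of $\gamma_r^t$ commute with $E^t(\mathfrak A_t^r)$; 3. $\gamma_r^t\circ\gamma_s^{t+r}=\gamma_{r+s}^t$ for all $t,r,s\ge0$, and $\gamma_0^t=\mathrm{id}$ whenever $\pi^t$ is onto; 4. $\gamma_r^{t-r}(E^t(\Delta))=E^{t-r}(\Delta)$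 for $0\le r\le t$ and $\Delta\in\mathfrak A_t$; 5. $\pi_t(E^t(\Delta))=E(\Delta)$ for $\Delta\in\mathfrak A_t$, and $\pi_t\circ\gamma_r^t=\pi_{t+r}$; 6. for $r>0$, $\Upsilon_r^t(\Delta,q)=E^t(\Delta)\gamma_r^t(q\otimes1)$, $\Delta\in\mathfrak A_t^r$, $q\in\mathfrak b(t+r)$, is a spectral transfer measure with values in $\mathfrak b(t)\bar\otimes\mathcal A_t^r$: it is normal, linear and $*$-preserving in $q$, strongly countably additive in $\Delta$, satisfies $\Upsilon_r^t(\Delta\cap\Gamma,qp)=\Upsilon_r^t(\Delta,q)\Upsilon_r^t(\Gamma,p)$ and $\Upsilon_r^t(\Omega,1)=1$; 7. with $\Upsilon_r^t(\Delta,x)=E^t(\Delta)\gamma_r^t(x)$ for $x\in\mathfrak b(t+r)\bar\otimes\mathcal A_{t+r}$, one has for $0<r\le t$, $s>0$, $\Delta\in\mathfrak A_{t-r}^r$, $\Gamma\in\mathfrak A_t^s$ that $\Delta\cap\Gamma\in\mathfrak A_{t-r}^{r+s}$ and $$\Upsilon_r^{t-r}\bigl(\Delta,\Upsilon_s^t(\Gamma,x)\bigr)=\Upsilon_{r+s}^{t-r}(\Delta\cap\Gamma,x),\qquad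 x\in\mathfrak b(t+s)\bar\otimes\mathcal A_{t+s},$$ in particular for $x=q\otimes 1$, $q\in\mathfrak b(t+s)$. -/

import Mathlib

open scoped NNReal TensorProduct InnerProductSpace MeasureTheory

namespace Eventum

noncomputable section

/-! ### The Hilbert space tensor product and the ampliations `x ↦ x ⊗ 1`, `y ↦ 1 ⊗ y` -/

/-- The Hilbert space tensor product: the completion of the algebraic tensor product in the norm
of the inner product `⟪x ⊗ y, x' ⊗ y'⟫ = ⟪x, x'⟫ ⟪y, y'⟫`. -/
abbrev HTensor (E F : Type*) [NormedAddCommGroup E] [InnerProductSpace ℂ E]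
    [NormedAddCommGroup F] [InnerProductSpace ℂ F] : Type _ :=
  UniformSpace.Completion (E ⊗[ℂ] F)

section Ampliation

variable {E F : Type*} [NormedAddCommGroup E] [InnerProductSpace ℂ E]
  [NormedAddCommGroup F] [InnerProductSpace ℂ F]

theorem norm_rTensor_le (T : E →L[ℂ] E) (z : E ⊗[ℂ] F) :
    ‖LinearMap.rTensor F (T : E →ₗ[ℂ] E) z‖ ≤ ‖T‖ * ‖z‖ := by
  classical
  obtain ⟨F', hF', hz⟩ :
      ∃ F' : Submodule ℂ F, Module.Finite ℂ F' ∧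
        z ∈ LinearMap.range (LinearMap.lTensor E F'.subtype) := by
    obtain ⟨E', F', -, iF', hz⟩ :=
      TensorProduct.exists_finite_submodule_of_setFinite {z} (Set.finite_singleton z)
    obtain ⟨y, rfl⟩ := Set.singleton_subset_iff.mp hz
    refine ⟨F', iF', LinearMap.rTensor F' E'.subtype y, ?_⟩
    rw [← LinearMap.comp_apply, LinearMap.lTensor_comp_rTensor]
  obtain ⟨y, rfl⟩ := hz
  let e := stdOrthonormalBasis ℂ F'
  have key : ∃ c : Fin (Module.finrank ℂ F') → E, y = ∑ i, c i ⊗ₜ[ℂ] e i := by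
    induction y with
    | zero => exact ⟨0, by simp⟩
    | tmul x w =>
      refine ⟨fun i => e.repr w i • x, ?_⟩
      conv_lhs => rw [← e.sum_repr w]
      simp [TensorProduct.tmul_sum, TensorProduct.smul_tmul]
    | add y₁ y₂ h₁ h₂ =>
      obtain ⟨c₁, rfl⟩ := h₁
      obtain ⟨c₂, rfl⟩ := h₂
      exact ⟨c₁ + c₂, by simp [TensorProduct.add_tmul, Finset.sum_add_distrib]⟩
  obtain ⟨c, rfl⟩ := key
  have norm_sq : ∀ d : Fin (Module.finrank ℂ F') → E,
      ‖∑ i, d i ⊗ₜ[ℂ] ((e i : F') : F)‖ ^ 2 = ∑ i, ‖d i‖ ^ 2 := by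
    intro d
    have h : (inner ℂ (∑ i, d i ⊗ₜ[ℂ] ((e i : F') : F)) (∑ i, d i ⊗ₜ[ℂ] ((e i : F') : F)) : ℂ)
        = ∑ i, (inner ℂ (d i) (d i) : ℂ) := by
      simp only [sum_inner, inner_sum, TensorProduct.inner_tmul]
      refine Finset.sum_congr rfl fun i _ => ?_
      rw [Finset.sum_eq_single i]
      · have hn : (inner ℂ ((e i : F') : F) ((e i : F') : F) : ℂ) = 1 := by
          rw [inner_self_eq_norm_sq_to_K]
          have : ‖((e i : F') : F)‖ = 1 := e.orthonormal.1 i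
          simp [this]
        rw [hn, mul_one]
      · intro j _ hj
        have hz' : (inner ℂ ((e j : F') : F) ((e i : F') : F) : ℂ) = 0 :=
          e.orthonormal.2 hj
        simp [hz']
      · simp
    have h' : ‖∑ i, d i ⊗ₜ[ℂ] ((e i : F') : F)‖ ^ 2 = (∑ i, ‖d i‖ ^ 2 : ℝ) := by
      have h3 := (inner_self_eq_norm_sq_to_K (𝕜 := ℂ)
        (∑ i, d i ⊗ₜ[ℂ] ((e i : F') : F))).symm.trans (h.trans
        (Finset.sum_congr rfl fun i _ => inner_self_eq_norm_sq_to_K (𝕜 := ℂ) (d i)))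
      exact_mod_cast h3
    exact h'
  have e1 : LinearMap.lTensor E F'.subtype (∑ i, c i ⊗ₜ[ℂ] e i)
      = ∑ i, c i ⊗ₜ[ℂ] ((e i : F') : F) := by simp
  have e2 : LinearMap.rTensor F (T : E →ₗ[ℂ] E) (∑ i, c i ⊗ₜ[ℂ] ((e i : F') : F))
      = ∑ i, T (c i) ⊗ₜ[ℂ] ((e i : F') : F) := by simp
  rw [e1, e2]
  refine le_of_sq_le_sq ?_ (by positivity)
  rw [mul_pow, norm_sq, norm_sq, Finset.mul_sum]
  refine Finset.sum_le_sum fun i _ => ?_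
  rw [← mul_pow]
  gcongr
  exact T.le_opNorm _

theorem norm_lTensor_le (T : F →L[ℂ] F) (z : E ⊗[ℂ] F) :
    ‖LinearMap.lTensor E (T : F →ₗ[ℂ] F) z‖ ≤ ‖T‖ * ‖z‖ := by
  have h := norm_rTensor_le (F := E) T (TensorProduct.comm ℂ E F z)
  rw [LinearMap.rTensor_comm] at h
  simpa using h

/-- The operator `x ⊗ 1` on the Hilbert space tensor product. -/
def ampL (F : Type*) [NormedAddCommGroup F] [InnerProductSpace ℂ F] (x : E →L[ℂ] E) :
    HTensor E F →L[ℂ] HTensor E F :=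
  ((LinearMap.rTensor F (x : E →ₗ[ℂ] E)).mkContinuous ‖x‖ (norm_rTensor_le x)).completion

/-- The operator `1 ⊗ y` on the Hilbert space tensor product. -/
def ampR (E : Type*) [NormedAddCommGroup E] [InnerProductSpace ℂ E] (y : F →L[ℂ] F) :
    HTensor E F →L[ℂ] HTensor E F :=
  ((LinearMap.lTensor E (y : F →ₗ[ℂ] F)).mkContinuous ‖y‖ (norm_lTensor_le y)).completion

theorem ampL_tmul (x : E →L[ℂ] E) (v : E) (w : F) :
    ampL F x ((v ⊗ₜ[ℂ] w : E ⊗[ℂ] F) : HTensor E F)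
      = ((x v ⊗ₜ[ℂ] w : E ⊗[ℂ] F) : HTensor E F) := by
  simp [ampL]

theorem ampR_tmul (y : F →L[ℂ] F) (v : E) (w : F) :
    ampR E y ((v ⊗ₜ[ℂ] w : E ⊗[ℂ] F) : HTensor E F)
      = ((v ⊗ₜ[ℂ] y w : E ⊗[ℂ] F) : HTensor E F) := by
  simp [ampR]

end Ampliation

/-! ### von Neumann algebras: generation, meet, join, tensor product -/

section Algebras

variable {H K : Type*} [NormedAddCommGroup H] [InnerProductSpace ℂ H] [CompleteSpace H]
  [NormedAddCommGroup K] [InnerProductSpace ℂ K] [CompleteSpace K]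

/-- The von Neumann algebra generated by a set of operators: the double commutant of the
star-closure of the set. -/
def vnGen (s : Set (H →L[ℂ] H)) : VonNeumannAlgebra H where
  toStarSubalgebra :=
    StarSubalgebra.centralizer ℂ (StarSubalgebra.centralizer ℂ s : Set (H →L[ℂ] H))
  centralizer_centralizer' := by simp

theorem subset_vnGen (s : Set (H →L[ℂ] H)) : s ⊆ (vnGen s : Set (H →L[ℂ] H)) := by
  intro x hx
  change x ∈ StarSubalgebra.centralizer ℂ (StarSubalgebra.centralizer ℂ s : Set (H →L[ℂ] H))
  rw [StarSubalgebra.mem_centralizer_iff]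
  intro g hg
  have hg' := (StarSubalgebra.mem_centralizer_iff ℂ).mp hg x hx
  have hg'' := (StarSubalgebra.mem_centralizer_iff ℂ).mp (star_mem hg) x hx
  exact ⟨hg'.1.symm, hg''.1.symm⟩

/-- The intersection of two von Neumann algebras. -/
def vnInf (M N : VonNeumannAlgebra H) : VonNeumannAlgebra H where
  toStarSubalgebra := M.toStarSubalgebra ⊓ N.toStarSubalgebra
  centralizer_centralizer' := by
    apply Set.Subset.antisymm _ Set.subset_centralizer_centralizer
    intro x hx
    refine ⟨?_, ?_⟩
    · change x ∈ M.carrier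
      rw [← M.centralizer_centralizer']
      exact Set.centralizer_subset (Set.centralizer_subset fun y hy => hy.1) hx
    · change x ∈ N.carrier
      rw [← N.centralizer_centralizer']
      exact Set.centralizer_subset (Set.centralizer_subset fun y hy => hy.2) hx

/-- The von Neumann algebra `M ∨ N` generated by `M` and `N`. -/
def vnSup (M N : VonNeumannAlgebra H) : VonNeumannAlgebra H :=
  vnGen ((M : Set (H →L[ℂ] H)) ∪ N)

/-- The von Neumann algebra tensor product, generated by the operators `x ⊗ 1` with `x ∈ M` and
`1 ⊗ y` with `y ∈ N` on the Hilbert space tensor product. -/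
def vnTensor (M : VonNeumannAlgebra H) (N : VonNeumannAlgebra K) :
    VonNeumannAlgebra (HTensor H K) :=
  vnGen (ampL K '' (M : Set (H →L[ℂ] H)) ∪ ampR H '' (N : Set (K →L[ℂ] K)))

/-- The star algebra of elements of a von Neumann algebra. -/
abbrev Elt (M : VonNeumannAlgebra H) : Type _ := M.toStarSubalgebra

/-- The element `x ⊗ 1` of `M ⊗ N`. -/
def inl (M : VonNeumannAlgebra H) (N : VonNeumannAlgebra K) (x : Elt M) : Elt (vnTensor M N) :=
  ⟨ampL K x, subset_vnGen _ (Or.inl ⟨x, x.2, rfl⟩)⟩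

/-- The element `1 ⊗ y` of `M ⊗ N`. -/
def inr (M : VonNeumannAlgebra H) (N : VonNeumannAlgebra K) (y : Elt N) : Elt (vnTensor M N) :=
  ⟨ampR H y, subset_vnGen _ (Or.inr ⟨y, y.2, rfl⟩)⟩

/-- Ultraweakly continuous linear functionals on `M`: those of the form `x ↦ ∑ₙ ⟪ξₙ, x ηₙ⟫` with
square summable sequences `ξ`, `η`. -/
def IsUltraweak (M : VonNeumannAlgebra H) (φ : Elt M → ℂ) : Prop :=
  ∃ ξ η : ℕ → H, Summable (fun n => ‖ξ n‖ ^ 2) ∧ Summable (fun n => ‖η n‖ ^ 2) ∧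
    ∀ x : Elt M, φ x = ∑' n, ⟪ξ n, (x : H →L[ℂ] H) (η n)⟫_ℂ

/-- Normality (ultraweak continuity) of a linear map from `M` into the operators on `K`: its
composition with every ultraweakly continuous functional is ultraweakly continuous. -/
def IsNormalMap (M : VonNeumannAlgebra H) (f : Elt M → (K →L[ℂ] K)) : Prop :=
  ∀ ξ η : ℕ → K, Summable (fun n => ‖ξ n‖ ^ 2) → Summable (fun n => ‖η n‖ ^ 2) →
    IsUltraweak M fun x => ∑' n, ⟪ξ n, f x (η n)⟫_ℂ

/-- A normal (unital) star homomorphism, i.e. a W*-homomorphism. -/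
def IsWStarHom {M : VonNeumannAlgebra H} {N : VonNeumannAlgebra K}
    (f : Elt M →⋆ₐ[ℂ] Elt N) : Prop :=
  IsNormalMap M fun x => (f x : K →L[ℂ] K)

/-- `P` is the W*-tensor product of its subalgebras `M` and `N`: there is a W*-isomorphism of
`M ⊗ N` onto `P` which extends `x ⊗ y ↦ x y`. -/
def IsWStarProduct (M N P : VonNeumannAlgebra H) : Prop :=
  ∃ θ : Elt (vnTensor M N) ≃⋆ₐ[ℂ] Elt P,
    IsNormalMap (vnTensor M N) (fun z => (θ z : H →L[ℂ] H)) ∧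
    IsNormalMap P (fun z => (θ.symm z : HTensor H H →L[ℂ] HTensor H H)) ∧
    (∀ x : Elt M, (θ (inl M N x) : H →L[ℂ] H) = x) ∧
    (∀ y : Elt N, (θ (inr M N y) : H →L[ℂ] H) = y)

/-- A `σ`-homomorphism of the `σ`-algebra `m` into the orthoprojectors on `H`; the values of `E`
on sets which are not `m`-measurable are irrelevant. -/
structure IsSigmaHom {Ω : Type*} (m : MeasurableSpace Ω) (E : Set Ω → (H →L[ℂ] H)) : Prop where
  isStarProjection : ∀ Δ, MeasurableSet[m] Δ → IsStarProjection (E Δ)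
  inter : ∀ Δ Γ, MeasurableSet[m] Δ → MeasurableSet[m] Γ → E (Δ ∩ Γ) = E Δ * E Γ
  univ : E Set.univ = 1
  iUnion : ∀ D : ℕ → Set Ω, (∀ n, MeasurableSet[m] (D n)) → Pairwise (Function.onFun Disjoint D) →
    ∀ ψ : H, HasSum (fun n => E (D n) ψ) (E (⋃ n, D n) ψ)

/-- A spectral (homomorphic) transfer measure on the `σ`-algebra `m`: for each event a normal
linear star map of `M` into `N`, countably additive in the event in the strong operator sense,
multiplicative jointly in the event and the algebra element, and normalized to the identity. -/
structure IsSpectralTransferMeasure {Ω : Type*} (m : MeasurableSpace Ω)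
    (M : VonNeumannAlgebra H) (N : VonNeumannAlgebra K)
    (F : Set Ω → Elt M → (K →L[ℂ] K)) : Prop where
  map_mem : ∀ Δ, MeasurableSet[m] Δ → ∀ x, F Δ x ∈ N
  map_add : ∀ Δ, MeasurableSet[m] Δ → ∀ x y, F Δ (x + y) = F Δ x + F Δ y
  map_smul : ∀ Δ, MeasurableSet[m] Δ → ∀ (c : ℂ) (x), F Δ (c • x) = c • F Δ x
  map_star : ∀ Δ, MeasurableSet[m] Δ → ∀ x, F Δ (star x) = star (F Δ x)
  inter_mul : ∀ Δ Γ, MeasurableSet[m] Δ → MeasurableSet[m] Γ → ∀ x y,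
    F (Δ ∩ Γ) (x * y) = F Δ x * F Γ y
  normal : ∀ Δ, MeasurableSet[m] Δ → IsNormalMap M (F Δ)
  univ_one : F Set.univ 1 = 1
  iUnion : ∀ D : ℕ → Set Ω, (∀ n, MeasurableSet[m] (D n)) → Pairwise (Function.onFun Disjoint D) →
    ∀ (x : Elt M) (ψ : K), HasSum (fun n => F (D n) x ψ) (F (⋃ n, D n) x ψ)

end Algebras

/-! ### Quantum dynamics with observable events -/

section Dynamics

/-- The quantum system with trajectories: the algebra `B` of all properties on `H`, the increasing
family `Bpast t` (`B_{t]}`), the decreasing families `Bfut t` (`B_{[t}`, present and future) and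
`A t` (the future noise), and the events of the trajectory space `Ω`, represented by the
`σ`-homomorphism `E`. The histories up to `t` and the future events after `t` are regarded as
sub-`σ`-algebras `past t` and `fut t` of the `σ`-algebra on `Ω` (cylinder sets), so that the
product of an event of a time interval and an event of the next one is their intersection. -/
structure TrajectorySystem (H : Type*) [NormedAddCommGroup H] [InnerProductSpace ℂ H]
    [CompleteSpace H] (Ω : Type*) [m : MeasurableSpace Ω] where
  B : VonNeumannAlgebra H
  Bpast : ℝ≥0 → VonNeumannAlgebra H
  Bfut : ℝ≥0 → VonNeumannAlgebra H
  A : ℝ≥0 → VonNeumannAlgebra H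
  past : ℝ≥0 → MeasurableSpace Ω
  fut : ℝ≥0 → MeasurableSpace Ω
  E : Set Ω → (H →L[ℂ] H)
  past_le : ∀ t, past t ≤ m
  fut_le : ∀ t, fut t ≤ m
  past_mono : Monotone past
  fut_anti : Antitone fut
  /-- The future events are generated by the events of the bounded intervals `[t, v)`. -/
  fut_eq : ∀ t, fut t = ⨆ v, ⨆ (_ : t < v), fut t ⊓ past v
  sigmaHom : IsSigmaHom m E
  E_mem : ∀ Δ, MeasurableSet Δ → E Δ ∈ B
  Bpast_mono : Monotone Bpast
  /-- `B` is generated by the algebras `B_{t]}`. -/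
  B_eq : B = vnGen (⋃ t, (Bpast t : Set (H →L[ℂ] H)))
  Bfut_anti : Antitone Bfut
  Bfut_le : ∀ t, Bfut t ≤ B
  A_anti : Antitone A
  A_le : ∀ t, A t ≤ Bfut t
  /-- `B_{t]}` is nonanticipating: it commutes with the future noise. -/
  Bpast_commute : ∀ t, ∀ x ∈ Bpast t, ∀ y ∈ A t, x * y = y * x
  /-- The histories are contained in `B_{t]}`. -/
  E_past_mem : ∀ t Δ, MeasurableSet[past t] Δ → E Δ ∈ Bpast t
  /-- Quantum causality (nondemolition): present and future commute with the past events. -/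
  causal : ∀ t Δ, MeasurableSet[past t] Δ → ∀ y ∈ Bfut t, E Δ * y = y * E Δ
  /-- The future events belong to the present-plus-future algebra. -/
  E_fut_mem : ∀ t Δ, MeasurableSet[fut t] Δ → E Δ ∈ Bfut t

namespace TrajectorySystem

variable {H : Type*} [NormedAddCommGroup H] [InnerProductSpace ℂ H] [CompleteSpace H]
  {Ω : Type*} [MeasurableSpace Ω] (S : TrajectorySystem H Ω)

/-- The `σ`-algebra of the events of the interval `[u, v)`. -/
abbrev incr (u v : ℝ≥0) : MeasurableSpace Ω := S.fut u ⊓ S.past v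

/-- The noise algebra `A u ∩ B_{v]}` of the interval `[u, v)`. -/
def noise (u v : ℝ≥0) : VonNeumannAlgebra H := vnInf (S.A u) (S.Bpast v)

/-- The W*-algebra generated by the history events up to `t`. -/
def Mpast (t : ℝ≥0) : VonNeumannAlgebra H := vnGen (S.E '' {Δ | MeasurableSet[S.past t] Δ})

/-- The W*-algebra generated by the future events after `t`. -/
def Mfut (t : ℝ≥0) : VonNeumannAlgebra H := vnGen (S.E '' {Δ | MeasurableSet[S.fut t] Δ})

/-- The event algebra of the interval `[u, v)`. -/
def Mincr (u v : ℝ≥0) : VonNeumannAlgebra H := vnInf (S.Mfut u) (S.Mpast v)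

/-- The families `B_{t]}` and `M_{t]}` form W*-product systems; for `B_{t]}` the final time may be
infinite, with the noise algebra `A t` after `t` and the whole algebra `B`. -/
structure IsProductSystem : Prop where
  properties : ∀ u v, u < v → IsWStarProduct (S.Bpast u) (S.noise u v) (S.Bpast v)
  properties_top : ∀ u, IsWStarProduct (S.Bpast u) (S.A u) S.B
  events : ∀ u v, u < v → IsWStarProduct (S.Mpast u) (S.Mincr u v) (S.Mpast v)

end TrajectorySystem

/-- A quantum open object: W*-algebras `bdry t` on the past-future boundary
`B_{[t]} = B_{t]} ∩ B_{[t}`, which represent W*-algebras `b t` (on Hilbert spaces `K t`) by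
W*-homomorphisms `rep t`, and normal injections `inj t` which are inverted by `rep t`. -/
structure OpenObject {H : Type*} [NormedAddCommGroup H] [InnerProductSpace ℂ H]
    [CompleteSpace H] {Ω : Type*} [MeasurableSpace Ω] (S : TrajectorySystem H Ω)
    (K : ℝ≥0 → Type*) [∀ t, NormedAddCommGroup (K t)] [∀ t, InnerProductSpace ℂ (K t)]
    [∀ t, CompleteSpace (K t)] where
  b : ∀ t, VonNeumannAlgebra (K t)
  bdry : ℝ≥0 → VonNeumannAlgebra H
  rep : ∀ t, Elt (b t) →⋆ₐ[ℂ] Elt (bdry t)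
  inj : ∀ t, Elt (bdry t) →⋆ₐ[ℂ] Elt (b t)
  bdry_le : ∀ t, bdry t ≤ vnInf (S.Bpast t) (S.Bfut t)
  rep_normal : ∀ t, IsWStarHom (rep t)
  inj_normal : ∀ t, IsWStarHom (inj t)
  rep_inj : ∀ t x, rep t (inj t x) = x

namespace OpenObject

variable {H : Type*} [NormedAddCommGroup H] [InnerProductSpace ℂ H] [CompleteSpace H]
  {Ω : Type*} [MeasurableSpace Ω] {S : TrajectorySystem H Ω}
  {K : ℝ≥0 → Type*} [∀ t, NormedAddCommGroup (K t)] [∀ t, InnerProductSpace ℂ (K t)]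
  [∀ t, CompleteSpace (K t)] (O : OpenObject S K)

/-- The open object is dynamical with respect to the noise. -/
def IsDynamical : Prop :=
  ∀ u v, u < v → vnSup (S.Mincr u v) (O.bdry v) ≤ vnSup (O.bdry u) (S.noise u v)

/-- The algebra `b t ⊗ A t`. -/
abbrev ext (t : ℝ≥0) : VonNeumannAlgebra (HTensor (K t) H) := vnTensor (O.b t) (S.A t)

/-- The subalgebra `b u ⊗ (A u ∩ B_{v]})` of `b u ⊗ A u`. -/
abbrev extIncr (u v : ℝ≥0) : VonNeumannAlgebra (HTensor (K u) H) :=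
  vnTensor (O.b u) (S.noise u v)

/-- Extended representations: W*-homomorphisms of `b t ⊗ A t` into `bdry t ∨ A t` with
`q ⊗ a ↦ rep t q * a`. -/
structure IsExtendedRep (R : ∀ t, Elt (O.ext t) →⋆ₐ[ℂ] Elt (vnSup (O.bdry t) (S.A t))) :
    Prop where
  normal : ∀ t, IsWStarHom (R t)
  apply_inl : ∀ t (q : Elt (O.b t)), (R t (inl (O.b t) (S.A t) q) : H →L[ℂ] H) = O.rep t q
  apply_inr : ∀ t (a : Elt (S.A t)), (R t (inr (O.b t) (S.A t) a) : H →L[ℂ] H) = a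

/-- Adapted event `σ`-homomorphisms on the future events after `t` with values in the projections
of `b t ⊗ A t`: an event of `[t, v)` is represented in `b t ⊗ (A t ∩ B_{v]})`. -/
structure IsAdaptedEvents (Et : ∀ t, Set Ω → Elt (O.ext t)) : Prop where
  sigmaHom : ∀ t, IsSigmaHom (S.fut t) fun Δ => (Et t Δ : HTensor (K t) H →L[ℂ] HTensor (K t) H)
  adapted : ∀ t v, t < v → ∀ Δ, MeasurableSet[S.incr t v] Δ →
    (Et t Δ : HTensor (K t) H →L[ℂ] HTensor (K t) H) ∈ O.extIncr t v

/-- A Heisenberg flow of causal tensor-adapted W*-homomorphisms, already extended trivially (with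
`1 ⊗ a ↦ 1 ⊗ a`) to `γ u v : b v ⊗ A v → b u ⊗ A u`. -/
structure IsCausalFlow (Et : ∀ t, Set Ω → Elt (O.ext t))
    (γ : ∀ u v, u ≤ v → (Elt (O.ext v) →⋆ₐ[ℂ] Elt (O.ext u))) : Prop where
  normal : ∀ u v h, IsWStarHom (γ u v h)
  /-- The elements of `b v` are mapped into `b u ⊗ (A u ∩ B_{v]})`. -/
  adapted : ∀ u v (h : u < v) (q : Elt (O.b v)),
    (γ u v h.le (inl (O.b v) (S.A v) q) : HTensor (K u) H →L[ℂ] HTensor (K u) H) ∈ O.extIncr u v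
  trivial_on_noise : ∀ u v h (a : Elt (S.A v)),
    (γ u v h (inr (O.b v) (S.A v) a) : HTensor (K u) H →L[ℂ] HTensor (K u) H) = ampR (K u) a
  /-- The values commute with the events of `[u, v)`. -/
  causal : ∀ u v (h : u < v) (x : Elt (O.ext v)) (Δ), MeasurableSet[S.incr u v] Δ →
    Et u Δ * γ u v h.le x = γ u v h.le x * Et u Δ
  hemigroup : ∀ u v w (h : u ≤ v) (h' : v ≤ w) (x : Elt (O.ext w)),
    γ u v h (γ v w h' x) = γ u w (h.trans h') x

/-- The transitional measure `Υ(Δ, x) = Et u Δ * γ u v x`, extended to `x ∈ b v ⊗ A v`. -/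
def transition (Et : ∀ t, Set Ω → Elt (O.ext t))
    (γ : ∀ u v, u ≤ v → (Elt (O.ext v) →⋆ₐ[ℂ] Elt (O.ext u))) (u v : ℝ≥0) (h : u ≤ v)
    (Δ : Set Ω) (x : Elt (O.ext v)) : Elt (O.ext u) :=
  Et u Δ * γ u v h x

end OpenObject

end Dynamics

end

end Eventum

namespace Eventum

noncomputable section

/-! ### Amplifications to Hilbert sums -/

section Amplification

variable {E F : Type*} [NormedAddCommGroup E] [InnerProductSpace ℂ E]
  [NormedAddCommGroup F] [InnerProductSpace ℂ F]

/-! Let C_t be the algebra generated by 𝔟_t and A_t (`bdryNoise`). Dynamicality makes C_t decrease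
in t and contain the future events E(𝔄_t). The product structure B ≅ B_{t]} ⊗ A_t identifies C_t
with 𝔟_t ⊗ A_t, so tensoring π_t and π^t with the identity of A_t gives normal homomorphisms R_t :
b(t) ⊗ A_t → C_t and J_t : C_t → b(t) ⊗ A_t with R_t J_t = id. Put E^t = J_t ∘ E, and let the flow
from v down to u be R_v, then the inclusion C_v ⊆ C_u, then J_u. The hemigroup law, the preservation
of events and the recovery of E and π_t are then cancellations of R_t J_t. Causality comes from C_v
⊆ B_{[v}, which commutes with the history up to v.

The analytic content is that a normal homomorphism f can be tensored with an identity
(`IsWStarHom.exists_tensor_id`). Each vector state of f is a vector state of an amplification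
(`IsWStarHom.exists_vector_state`), and a cyclic decomposition glues these into an isometry V that
intertwines f with a diagonal action (`IsWStarHom.exists_intertwiner`). The range of V ⊗ 1 reduces
the generators of the tensor product, and compressing to it defines the tensored homomorphism
(`exists_compression`).

Identities and inclusions are checked on generators only. They spread because an ultraweakly
continuous functional is a vector functional of an amplification, where von Neumann's density
argument applies (`diag_mem_closure_orbit`). Countable additivity of E^t is `IsWStarHom.isSigmaHom`.
-/

/-- The Hilbert sum of copies of `E` indexed by `J`. -/
abbrev Ampl (J E : Type*) [NormedAddCommGroup E] : Type _ := lp (fun _ : J => E) 2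

/-- The vector `v` in the `j`-th copy of `E`. -/
abbrev sgl {J : Type*} [DecidableEq J] (j : J) (v : E) : Ampl J E := lp.single 2 j v

omit [InnerProductSpace ℂ E] in
theorem memℓp_two_iff {J : Type*} {f : J → E} :
    Memℓp f 2 ↔ Summable fun j => ‖f j‖ ^ 2 := by
  rw [memℓp_gen_iff (by norm_num)]
  simp

omit [InnerProductSpace ℂ E] in
theorem Ampl.norm_sq_eq {J : Type*} (f : Ampl J E) : ‖f‖ ^ 2 = ∑' j, ‖f j‖ ^ 2 := by
  have h := lp.norm_rpow_eq_tsum (p := 2) (by norm_num) f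
  simpa using h

omit [InnerProductSpace ℂ E] in
theorem Ampl.summable_norm_sq {J : Type*} (f : Ampl J E) : Summable fun j => ‖f j‖ ^ 2 :=
  memℓp_two_iff.mp (lp.memℓp f)

theorem memℓp_map {J : Type*} (T : E →L[ℂ] F) (f : Ampl J E) : Memℓp (fun j => T (f j)) 2 := by
  rw [memℓp_two_iff]
  refine Summable.of_nonneg_of_le (fun j => by positivity) (fun j => ?_)
    (f.summable_norm_sq.mul_left (‖T‖ ^ 2))
  rw [← mul_pow]
  gcongr
  exact T.le_opNorm _

/-- The diagonal action of an operator on a Hilbert sum of copies. -/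
def amplMap (J : Type*) (T : E →L[ℂ] F) : Ampl J E →L[ℂ] Ampl J F :=
  LinearMap.mkContinuous
    { toFun := fun f => ⟨fun j => T (f j), memℓp_map T f⟩
      map_add' := fun f g => by ext j; exact map_add T _ _
      map_smul' := fun c f => by ext j; exact map_smul T _ _ } ‖T‖ fun f => by
    refine le_of_sq_le_sq ?_ (by positivity)
    rw [mul_pow, Ampl.norm_sq_eq, Ampl.norm_sq_eq, ← tsum_mul_left]
    refine Summable.tsum_le_tsum (fun j => ?_) (memℓp_two_iff.mp (memℓp_map T f))
      (f.summable_norm_sq.mul_left _)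
    rw [← mul_pow]
    change ‖T (f j)‖ ^ 2 ≤ _
    gcongr
    exact T.le_opNorm _

@[simp]
theorem amplMap_apply {J : Type*} (T : E →L[ℂ] F) (f : Ampl J E) (j : J) :
    amplMap J T f j = T (f j) := rfl

/-- The diagonal action as a star homomorphism. -/
def diag (J E : Type*) [NormedAddCommGroup E] [InnerProductSpace ℂ E] [CompleteSpace E] :
    (E →L[ℂ] E) →⋆ₐ[ℂ] (Ampl J E →L[ℂ] Ampl J E) where
  toFun := amplMap J
  map_one' := by ext f j; simp
  map_mul' S T := by ext f j; simp
  map_zero' := by ext f j; simp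
  map_add' S T := by ext f j; simp
  commutes' c := by ext f j; simp [Algebra.algebraMap_eq_smul_one]
  map_star' T := by
    rw [ContinuousLinearMap.star_eq_adjoint, ContinuousLinearMap.star_eq_adjoint,
      ContinuousLinearMap.eq_adjoint_iff]
    intro f g
    simp only [lp.inner_eq_tsum, amplMap_apply, ContinuousLinearMap.adjoint_inner_left]

@[simp]
theorem diag_apply {J : Type*} [CompleteSpace E] (T : E →L[ℂ] E) (f : Ampl J E) (j : J) :
    diag J E T f j = T (f j) := rfl

theorem diag_single {J : Type*} [DecidableEq J] [CompleteSpace E] (T : E →L[ℂ] E) (j : J)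
    (v : E) : diag J E T (sgl j v) = sgl j (T v) := by
  ext i
  rcases eq_or_ne i j with rfl | h
  · simp
  · simp [h]

theorem Ampl.clm_ext {J : Type*} [DecidableEq J] {S T : Ampl J E →L[ℂ] F}
    (h : ∀ j v, S (sgl j v) = T (sgl j v)) : S = T := by
  ext f
  have hf := lp.hasSum_single (p := 2) (by norm_num) f
  refine HasSum.unique (hf.mapL S) ?_
  simpa only [h] using hf.mapL T

/-- The matrix entries of an operator on a Hilbert sum. -/
def entry {J : Type*} [DecidableEq J] (P : Ampl J E →L[ℂ] Ampl J F) (i j : J) : E →L[ℂ] F :=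
  (lp.evalCLM ℂ (fun _ : J => F) 2 i) ∘L P ∘L
    (lp.singleContinuousLinearMap ℂ (fun _ : J => E) 2 j)

theorem entry_apply {J : Type*} [DecidableEq J] (P : Ampl J E →L[ℂ] Ampl J F) (i j : J) (v : E) :
    entry P i j v = P (sgl j v) i := rfl

/-- Vectors supported in one copy are total and coordinates separate points, so commutation can be
read off entry by entry. Commutation with diagonal generators thereby passes to the diagonal of the
whole double commutant. -/
theorem commute_diag_iff {J : Type*} [DecidableEq J] [CompleteSpace E]
    {P : Ampl J E →L[ℂ] Ampl J E} {x : E →L[ℂ] E} :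
    P * diag J E x = diag J E x * P ↔ ∀ i j, entry P i j * x = x * entry P i j := by
  constructor
  · intro h i j
    ext v
    have := congrArg (fun f : Ampl J E => f i) (DFunLike.congr_fun h (sgl j v))
    simpa [diag_single, entry_apply] using this
  · intro h
    refine Ampl.clm_ext fun j v => ?_
    ext i
    have := DFunLike.congr_fun (h i j) v
    simpa [diag_single, entry_apply] using this

end Amplification

/-! ### Bounded extension from dense subspaces and Gram matrices -/

section Extension

variable {X E F : Type*} [AddCommGroup X] [Module ℂ X] [NormedAddCommGroup E]
  [InnerProductSpace ℂ E] [CompleteSpace E] [NormedAddCommGroup F] [InnerProductSpace ℂ F]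
  [CompleteSpace F]

/-- A dominated linear map factors through a contraction which vanishes on the orthogonal
complement of the range of the dominating map. -/
theorem exists_clm_comp_eq (A : X →ₗ[ℂ] E) (B : X →ₗ[ℂ] F) (h : ∀ x, ‖B x‖ ≤ ‖A x‖) :
    ∃ T : E →L[ℂ] F, (∀ x, T (A x) = B x) ∧ ∀ v ∈ (LinearMap.range A)ᗮ, T v = 0 := by
  -- Extend from the closed range of `A` and precompose with its projection. The vanishing on the
  -- complement later makes `T` an intertwiner on the whole space.
  let U : Submodule ℂ E := (LinearMap.range A).topologicalClosure
  have : CompleteSpace U := (Submodule.isClosed_topologicalClosure _).completeSpace_coe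
  let A' : X →ₗ[ℂ] U := A.codRestrict U fun x =>
    Submodule.le_topologicalClosure _ (LinearMap.mem_range_self A x)
  have hd : DenseRange A' := by
    intro u
    rw [Topology.IsInducing.subtypeVal.closure_eq_preimage_closure_image]
    have hu : (u : E) ∈ closure (Set.range A) := u.2
    refine closure_mono ?_ hu
    rintro _ ⟨x, rfl⟩
    exact ⟨A' x, ⟨x, rfl⟩, rfl⟩
  have hn : ∃ C, ∀ x, ‖B x‖ ≤ C * ‖A' x‖ := ⟨1, fun x => by rw [one_mul]; exact h x⟩
  refine ⟨(B.extendOfNorm A') ∘L U.orthogonalProjectionOnto, fun x => ?_, fun v hv => ?_⟩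
  · have hx : U.orthogonalProjectionOnto (A x) = A' x :=
      Submodule.orthogonalProjectionOnto_mem_subspace_eq_self (A' x)
    simp only [ContinuousLinearMap.comp_apply, hx]
    exact LinearMap.extendOfNorm_eq hd hn x
  · have hv' : v ∈ Uᗮ := by rwa [Submodule.orthogonal_closure]
    rw [ContinuousLinearMap.comp_apply,
      U.orthogonalProjectionOnto_eq_zero_iff.mpr hv', map_zero]

/-- Two families with the same Gram matrix, the first of which is total, are related by an
isometry. -/
theorem exists_linearIsometry_of_inner_eq {I : Type*} (a : I → E) (b : I → F)
    (ha : (Submodule.span ℂ (Set.range a)).topologicalClosure = ⊤)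
    (h : ∀ i j, ⟪a i, a j⟫_ℂ = ⟪b i, b j⟫_ℂ) : ∃ V : E →ₗᵢ[ℂ] F, ∀ i, V (a i) = b i := by
  -- Working with formal combinations removes the question of well-definedness: equal Gram matrices
  -- give equal norms, and domination yields the factorization.
  let A := Finsupp.linearCombination ℂ a
  let B := Finsupp.linearCombination ℂ b
  have hin : ∀ c, ⟪A c, A c⟫_ℂ = ⟪B c, B c⟫_ℂ := fun c => by
    simp only [A, B, Finsupp.linearCombination_apply, Finsupp.sum, sum_inner, inner_sum,
      inner_smul_left, inner_smul_right, h]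
  have hn : ∀ c, ‖B c‖ = ‖A c‖ := fun c => by
    rw [@norm_eq_sqrt_re_inner ℂ, @norm_eq_sqrt_re_inner ℂ, hin]
  obtain ⟨T, hT, -⟩ := exists_clm_comp_eq A B fun c => (hn c).le
  have hiso : ∀ v, ‖T v‖ = ‖v‖ := by
    intro v
    have hv : v ∈ closure (Set.range A) := by
      have : v ∈ (Submodule.span ℂ (Set.range a)).topologicalClosure := ha ▸ trivial
      rw [← Finsupp.range_linearCombination] at this
      exact this
    have hc : IsClosed {v | ‖T v‖ = ‖v‖} := isClosed_eq (by fun_prop) (by fun_prop)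
    refine closure_minimal ?_ hc hv
    rintro _ ⟨c, rfl⟩
    change ‖T (A c)‖ = ‖A c‖
    rw [hT, hn]
  refine ⟨⟨T, hiso⟩, fun i => ?_⟩
  have := hT (Finsupp.single i 1)
  simpa [A, B] using this

omit [CompleteSpace E] [CompleteSpace F] in
theorem clm_ext_of_total {I : Type*} {a : I → E}
    (ha : (Submodule.span ℂ (Set.range a)).topologicalClosure = ⊤) {S T : E →L[ℂ] F}
    (h : ∀ i, S (a i) = T (a i)) : S = T := by
  refine ContinuousLinearMap.ext_on (Submodule.dense_iff_topologicalClosure_eq_top.mpr ha) ?_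
  rintro _ ⟨i, rfl⟩
  exact h i

end Extension

/-! ### Density in the double commutant and normal maps -/

section Density

variable {H K L : Type*} [NormedAddCommGroup H] [InnerProductSpace ℂ H] [CompleteSpace H]
  [NormedAddCommGroup K] [InnerProductSpace ℂ K] [CompleteSpace K]
  [NormedAddCommGroup L] [InnerProductSpace ℂ L] [CompleteSpace L]

/-- The generating set need not be closed under adjoints, so the test operator must commute with the
adjoints of the generators separately. -/
theorem mem_vnGen_iff {s : Set (H →L[ℂ] H)} {x : H →L[ℂ] H} :
    x ∈ vnGen s ↔ ∀ y : H →L[ℂ] H, (∀ g ∈ s, y * g = g * y) → (∀ g ∈ s, y * star g = star g * y) →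
      y * x = x * y := by
  change x ∈ StarSubalgebra.centralizer ℂ (StarSubalgebra.centralizer ℂ s : Set (H →L[ℂ] H)) ↔ _
  rw [StarSubalgebra.mem_centralizer_iff]
  constructor
  · intro h y h₁ h₂
    exact (h y ((StarSubalgebra.mem_centralizer_iff ℂ).mpr
      fun g hg => ⟨(h₁ g hg).symm, (h₂ g hg).symm⟩)).1
  · intro h y hy
    have hy' := (StarSubalgebra.mem_centralizer_iff ℂ).mp hy
    have hys := (StarSubalgebra.mem_centralizer_iff ℂ).mp (star_mem hy)
    exact ⟨h y (fun g hg => (hy' g hg).1.symm) (fun g hg => (hy' g hg).2.symm),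
      h (star y) (fun g hg => (hys g hg).1.symm) (fun g hg => (hys g hg).2.symm)⟩

theorem mem_iff_commutant {M : VonNeumannAlgebra H} {x : H →L[ℂ] H} :
    x ∈ M ↔ ∀ y : H →L[ℂ] H, (∀ g ∈ M, y * g = g * y) → y * x = x * y := by
  constructor
  · exact fun hx y hy => hy x hx
  · intro h
    rw [← SetLike.mem_coe, ← M.centralizer_centralizer, Set.mem_centralizer_iff]
    exact fun y hy => h y fun g hg => (Set.mem_centralizer_iff.mp hy g hg).symm

theorem vnGen_le {s : Set (H →L[ℂ] H)} {M : VonNeumannAlgebra H} (h : s ⊆ M) : vnGen s ≤ M := by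
  intro x hx
  rw [mem_iff_commutant]
  exact fun y hy => mem_vnGen_iff.mp hx y (fun g hg => hy g (h hg))
    fun g hg => hy _ (star_mem (h hg))

theorem vnGen_mono {s t : Set (H →L[ℂ] H)} (h : s ⊆ t) : vnGen s ≤ vnGen t :=
  vnGen_le (h.trans (subset_vnGen t))

theorem le_vnSup_left (M N : VonNeumannAlgebra H) : M ≤ vnSup M N :=
  fun _ hx => subset_vnGen _ (Or.inl hx)

theorem le_vnSup_right (M N : VonNeumannAlgebra H) : N ≤ vnSup M N :=
  fun _ hx => subset_vnGen _ (Or.inr hx)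

theorem vnSup_le {M N P : VonNeumannAlgebra H} (h₁ : M ≤ P) (h₂ : N ≤ P) : vnSup M N ≤ P :=
  vnGen_le (Set.union_subset h₁ h₂)

theorem vnTensor_mono {M M' : VonNeumannAlgebra H} {N N' : VonNeumannAlgebra K} (h₁ : M ≤ M')
    (h₂ : N ≤ N') : vnTensor M N ≤ vnTensor M' N' :=
  vnGen_mono (Set.union_subset_union (Set.image_mono h₁) (Set.image_mono h₂))

/-- The amplified orbit of a vector under a star algebra of operators is dense in its orbit under
the generated von Neumann algebra. -/
theorem diag_mem_closure_orbit (D : StarSubalgebra ℂ (H →L[ℂ] H)) {x : H →L[ℂ] H}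
    (hx : x ∈ vnGen (D : Set (H →L[ℂ] H))) (η : Ampl ℕ H) :
    diag ℕ H x η ∈ closure ((fun a => diag ℕ H a η) '' (D : Set (H →L[ℂ] H))) := by
  let ev : (H →L[ℂ] H) →ₗ[ℂ] Ampl ℕ H :=
    { toFun := fun a => diag ℕ H a η
      map_add' := fun a b => by simp
      map_smul' := fun c a => by simp }
  let U₀ : Submodule ℂ (Ampl ℕ H) := D.toSubalgebra.toSubmodule.map ev
  let U := U₀.topologicalClosure
  have : CompleteSpace U := (Submodule.isClosed_topologicalClosure _).completeSpace_coe
  have hU₀ : (U₀ : Set (Ampl ℕ H)) = (fun a => diag ℕ H a η) '' (D : Set (H →L[ℂ] H)) := rfl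
  have hinv : ∀ a ∈ D, ∀ v ∈ U, diag ℕ H a v ∈ U := by
    intro a ha v hv
    have hmaps : Set.MapsTo (diag ℕ H a) U₀ U₀ := by
      rintro _ ⟨b, hb, rfl⟩
      exact ⟨a * b, D.mul_mem ha hb, by simp [ev]⟩
    exact hmaps.closure (diag ℕ H a).continuous hv
  -- Von Neumann's argument: the closed orbit is invariant under a star algebra, so its projection
  -- commutes with it. The entries of the projection then lie in the commutant of `D`, so they
  -- commute with `x`. The unit of `D` puts `η` into the orbit.
  let P : Ampl ℕ H →L[ℂ] Ampl ℕ H := U.starProjection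
  have hcomm : ∀ a ∈ D, P * diag ℕ H a = diag ℕ H a * P := by
    intro a ha
    ext1 v
    have hv := U.starProjection_add_starProjection_orthogonal v
    have h₁ : P (diag ℕ H a (U.starProjection v)) = diag ℕ H a (U.starProjection v) :=
      Submodule.starProjection_eq_self_iff.mpr (hinv a ha _ (Submodule.starProjection_apply_mem _ _))
    have h₂ : P (diag ℕ H a (Uᗮ.starProjection v)) = 0 := by
      refine (Submodule.starProjection_apply_eq_zero_iff _).mpr ?_
      rw [Submodule.mem_orthogonal]
      intro u hu
      rw [← ContinuousLinearMap.adjoint_inner_left, ← ContinuousLinearMap.star_eq_adjoint,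
        ← map_star]
      exact (Submodule.mem_orthogonal _ _).mp (Submodule.starProjection_apply_mem Uᗮ v) _
        (hinv _ (star_mem ha) _ hu)
    change P (diag ℕ H a v) = diag ℕ H a (P v)
    conv_lhs => rw [← hv, map_add, map_add, h₁, h₂, add_zero]
  have hPx : P * diag ℕ H x = diag ℕ H x * P := by
    rw [commute_diag_iff]
    exact fun i j => mem_vnGen_iff.mp hx _ (fun g hg => commute_diag_iff.mp (hcomm g hg) i j)
      fun g hg => commute_diag_iff.mp (hcomm _ (star_mem hg)) i j
  have hη : η ∈ U := Submodule.le_topologicalClosure _ ⟨1, one_mem D, by simp [ev]⟩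
  have hmem : diag ℕ H x η ∈ U := by
    have h := DFunLike.congr_fun hPx η
    have hPη : P η = η := Submodule.starProjection_eq_self_iff.mpr hη
    change P (diag ℕ H x η) = diag ℕ H x (P η) at h
    rw [hPη] at h
    exact Submodule.starProjection_eq_self_iff.mp h
  rw [← hU₀]
  exact hmem

/-- Amplification absorbs the countable sum into one inner product, so Hilbert space geometry
applies to ultraweak functionals. -/
theorem isUltraweak_iff {M : VonNeumannAlgebra H} {φ : Elt M → ℂ} :
    IsUltraweak M φ ↔ ∃ ξ η : Ampl ℕ H, ∀ x : Elt M, φ x = ⟪ξ, diag ℕ H (x : H →L[ℂ] H) η⟫_ℂ := by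
  constructor
  · rintro ⟨ξ, η, hξ, hη, h⟩
    refine ⟨⟨ξ, memℓp_two_iff.mpr hξ⟩, ⟨η, memℓp_two_iff.mpr hη⟩, fun x => ?_⟩
    rw [h, lp.inner_eq_tsum]
    rfl
  · rintro ⟨ξ, η, h⟩
    refine ⟨ξ, η, ξ.summable_norm_sq, η.summable_norm_sq, fun x => ?_⟩
    rw [h, lp.inner_eq_tsum]
    rfl

theorem isNormalMap_iff {M : VonNeumannAlgebra H} {f : Elt M → (K →L[ℂ] K)} :
    IsNormalMap M f ↔ ∀ ξ η : Ampl ℕ K, IsUltraweak M fun x => ⟪ξ, diag ℕ K (f x) η⟫_ℂ := by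
  constructor
  · intro h ξ η
    have := h ξ η ξ.summable_norm_sq η.summable_norm_sq
    simp only [lp.inner_eq_tsum]
    exact this
  · intro h ξ η hξ hη
    have := h ⟨ξ, memℓp_two_iff.mpr hξ⟩ ⟨η, memℓp_two_iff.mpr hη⟩
    simp only [lp.inner_eq_tsum] at this
    exact this

/-- Functionals given by square summable families with arbitrary index set are ultraweakly
continuous. -/
theorem isUltraweak_inner_diag (M : VonNeumannAlgebra H) {J : Type*} (ξ η : Ampl J H) :
    IsUltraweak M fun x => ⟪ξ, diag J H (x : H →L[ℂ] H) η⟫_ℂ := by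
  have hc : ∀ ζ : Ampl J H, {j | ζ j ≠ 0}.Countable := fun ζ => by
    have := ζ.summable_norm_sq.countable_support
    refine this.mono fun j hj => ?_
    simpa using hj
  -- Square summable families have countable support, so the indices that matter can be renumbered
  -- by natural numbers.
  let C : Set J := {j | ξ j ≠ 0} ∪ {j | η j ≠ 0}
  have : Countable C := ((hc ξ).union (hc η)).to_subtype
  obtain ⟨e, he⟩ := exists_injective_nat C
  let ext : Ampl J H → ℕ → H := fun ζ => Function.extend e (fun j : C => ζ j) 0
  have hext : ∀ ζ : Ampl J H, Summable fun n => ‖ext ζ n‖ ^ 2 := by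
    intro ζ
    have h₁ : (fun n => ‖ext ζ n‖ ^ 2) = Function.extend e (fun j : C => ‖ζ j‖ ^ 2) 0 := by
      funext n
      by_cases hn : ∃ j, e j = n
      · obtain ⟨j, rfl⟩ := hn
        simp [ext, he.extend_apply]
      · simp [ext, Function.extend_apply' _ _ _ hn]
    rw [h₁, summable_extend_zero he]
    exact ζ.summable_norm_sq.subtype C
  refine ⟨ext ξ, ext η, hext ξ, hext η, fun x => ?_⟩
  have h₂ : (fun n => ⟪ext ξ n, (x : H →L[ℂ] H) (ext η n)⟫_ℂ)
      = Function.extend e (fun j : C => ⟪ξ j, (x : H →L[ℂ] H) (η j)⟫_ℂ) 0 := by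
    funext n
    by_cases hn : ∃ j, e j = n
    · obtain ⟨j, rfl⟩ := hn
      simp [ext, he.extend_apply]
    · simp [ext, Function.extend_apply' _ _ _ hn]
  rw [h₂, tsum_extend_zero he]
  change ⟪ξ, diag J H (x : H →L[ℂ] H) η⟫_ℂ = _
  rw [lp.inner_eq_tsum]
  simp only [diag_apply]
  symm
  refine tsum_subtype_eq_of_support_subset (f := fun j => ⟪ξ j, (x : H →L[ℂ] H) (η j)⟫_ℂ)
    fun j hj => ?_
  refine Or.inl fun h => hj ?_
  simp [h]

/-- The concatenation of two elements of Hilbert sums. -/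
def Ampl.elim {I J : Type*} (ξ : Ampl I H) (η : Ampl J H) : Ampl (I ⊕ J) H :=
  ⟨Sum.elim ξ η, memℓp_two_iff.mpr (HasSum.sum (f := fun j => ‖Sum.elim ξ η j‖ ^ 2)
    ξ.summable_norm_sq.hasSum η.summable_norm_sq.hasSum).summable⟩

theorem Ampl.inner_elim_diag_elim {I J : Type*} (ξ η : Ampl I H) (ξ' η' : Ampl J H)
    (x : H →L[ℂ] H) : ⟪ξ.elim ξ', diag (I ⊕ J) H x (η.elim η')⟫_ℂ
      = ⟪ξ, diag I H x η⟫_ℂ + ⟪ξ', diag J H x η'⟫_ℂ :=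
  (lp.hasSum_inner (ξ.elim ξ') (diag (I ⊕ J) H x (η.elim η'))).unique
    (HasSum.sum (lp.hasSum_inner ξ (diag I H x η)) (lp.hasSum_inner ξ' (diag J H x η')))

theorem IsUltraweak.sub {M : VonNeumannAlgebra H} {φ ψ : Elt M → ℂ} (hφ : IsUltraweak M φ)
    (hψ : IsUltraweak M ψ) : IsUltraweak M fun x => φ x - ψ x := by
  obtain ⟨ξ, η, h⟩ := isUltraweak_iff.mp hφ
  obtain ⟨ξ', η', h'⟩ := isUltraweak_iff.mp hψ
  have key := isUltraweak_inner_diag M (ξ.elim ξ') (η.elim (-η'))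
  simp only [Ampl.inner_elim_diag_elim, map_neg, inner_neg_right, ← sub_eq_add_neg] at key
  simpa only [h, h'] using key

/-- An ultraweakly continuous functional which vanishes on a star algebra vanishes on the von
Neumann algebra generated by it. -/
theorem IsUltraweak.eq_zero {M : VonNeumannAlgebra H} {φ : Elt M → ℂ} (hφ : IsUltraweak M φ)
    (D : StarSubalgebra ℂ (Elt M)) (hD : ∀ a ∈ D, φ a = 0)
    (hM : M ≤ vnGen ((↑) '' (D : Set (Elt M)))) (x : Elt M) : φ x = 0 := by
  obtain ⟨ξ, η, h⟩ := isUltraweak_iff.mp hφ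
  have hx := diag_mem_closure_orbit (D.map M.toStarSubalgebra.subtype) (x := (x : H →L[ℂ] H))
    (hM x.2) η
  have hc : IsClosed {v : Ampl ℕ H | ⟪ξ, v⟫_ℂ = 0} := isClosed_eq (by fun_prop) (by fun_prop)
  rw [h]
  refine closure_minimal ?_ hc hx
  rintro _ ⟨_, ⟨a, ha, rfl⟩, rfl⟩
  exact (h a).symm.trans (hD a ha)

/-- Normal homomorphisms which agree on generators are equal. -/
theorem starAlgHom_ext_of_normal {M : VonNeumannAlgebra H} {N : VonNeumannAlgebra K}
    {f g : Elt M →⋆ₐ[ℂ] Elt N} (hf : IsWStarHom f) (hg : IsWStarHom g) (s : Set (Elt M))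
    (hs : M ≤ vnGen ((↑) '' s)) (h : ∀ a ∈ s, f a = g a) : f = g := by
  let D : StarSubalgebra ℂ (Elt M) := StarAlgHom.equalizer f g
  have hM : M ≤ vnGen ((↑) '' (D : Set (Elt M))) := hs.trans (vnGen_mono (Set.image_mono h))
  ext1 x
  refine Subtype.ext ?_
  ext1 v
  refine ext_inner_left ℂ fun w => sub_eq_zero.mp ?_
  have key := ((isNormalMap_iff.mp hf (sgl 0 w) (sgl 0 v)).sub
    (isNormalMap_iff.mp hg (sgl 0 w) (sgl 0 v))).eq_zero D (fun a ha => ?_) hM x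
  · simpa [diag_single, lp.inner_single_left] using key
  · have hfg : f a = g a := ha
    simp [hfg]

/-- A normal homomorphism which maps generators into a von Neumann algebra maps everything into
it. -/
theorem IsNormalMap.apply_mem {M : VonNeumannAlgebra H} {f : Elt M →⋆ₐ[ℂ] (K →L[ℂ] K)}
    (hf : IsNormalMap M f) (P : VonNeumannAlgebra K) (s : Set (Elt M))
    (hs : M ≤ vnGen ((↑) '' s)) (h : ∀ a ∈ s, f a ∈ P) (x : Elt M) : f x ∈ P := by
  let D : StarSubalgebra ℂ (Elt M) := P.toStarSubalgebra.comap f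
  have hM : M ≤ vnGen ((↑) '' (D : Set (Elt M))) := hs.trans (vnGen_mono (Set.image_mono h))
  rw [mem_iff_commutant]
  intro y hy
  ext1 v
  refine ext_inner_left ℂ fun w => sub_eq_zero.mp ?_
  -- This is the matrix coefficient of `y * f x - f x * y` between `w` and `v`, with `y` moved to
  -- the left vector as an adjoint so that normality of `f` applies to each term.
  have key := ((isNormalMap_iff.mp hf (sgl 0 (star y w)) (sgl 0 v)).sub
    (isNormalMap_iff.mp hf (sgl 0 w) (sgl 0 (y v)))).eq_zero D (fun a ha => ?_) hM x
  · simpa [diag_single, lp.inner_single_left, ContinuousLinearMap.star_eq_adjoint,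
      ContinuousLinearMap.adjoint_inner_left] using key
  · have hya : y (f a v) = f a (y v) := DFunLike.congr_fun (hy _ ha) v
    simp [diag_single, lp.inner_single_left, ContinuousLinearMap.star_eq_adjoint,
      ContinuousLinearMap.adjoint_inner_left, hya]

omit [CompleteSpace L] in
theorem IsNormalMap.comp {M : VonNeumannAlgebra H} {N : VonNeumannAlgebra K}
    {g : Elt N → (L →L[ℂ] L)} (hg : IsNormalMap N g) {f : Elt M → Elt N}
    (hf : IsNormalMap M fun x => (f x : K →L[ℂ] K)) : IsNormalMap M fun x => g (f x) := by
  intro ξ η hξ hη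
  obtain ⟨ξ', η', hξ', hη', h⟩ := hg ξ η hξ hη
  simp only [h]
  exact hf ξ' η' hξ' hη'

theorem IsWStarHom.comp {M : VonNeumannAlgebra H} {N : VonNeumannAlgebra K}
    {P : VonNeumannAlgebra L} {g : Elt N →⋆ₐ[ℂ] Elt P} {f : Elt M →⋆ₐ[ℂ] Elt N}
    (hg : IsWStarHom g) (hf : IsWStarHom f) : IsWStarHom (g.comp f) :=
  IsNormalMap.comp hg hf

theorem isNormalMap_coe (M : VonNeumannAlgebra H) : IsNormalMap M fun x => (x : H →L[ℂ] H) :=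
  fun ξ η hξ hη => ⟨ξ, η, hξ, hη, fun _ => rfl⟩

theorem IsNormalMap.const_mul {M : VonNeumannAlgebra H} {f : Elt M → (K →L[ℂ] K)}
    (hf : IsNormalMap M f) (T : K →L[ℂ] K) : IsNormalMap M fun x => T * f x := by
  rw [isNormalMap_iff]
  intro ξ η
  convert isNormalMap_iff.mp hf (diag ℕ K (star T) ξ) η using 2 with x
  rw [map_mul, map_star, ContinuousLinearMap.star_eq_adjoint,
    ContinuousLinearMap.adjoint_inner_left]
  rfl

end Density

/-! ### The spatial form of a normal homomorphism -/

section Spatial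

variable {H K : Type*} [NormedAddCommGroup H] [InnerProductSpace ℂ H] [CompleteSpace H]
  [NormedAddCommGroup K] [InnerProductSpace ℂ K] [CompleteSpace K]
  {M : VonNeumannAlgebra H} {N : VonNeumannAlgebra K}

theorem inner_star_mul (S T : H →L[ℂ] H) (v w : H) : ⟪v, (star S * T) w⟫_ℂ = ⟪S v, T w⟫_ℂ := by
  rw [ContinuousLinearMap.star_eq_adjoint, ← ContinuousLinearMap.adjoint_inner_right]
  rfl

theorem inner_map_star_mul (f : Elt M →⋆ₐ[ℂ] Elt N) (x y : Elt M) (v w : K) :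
    ⟪v, (f (star x * y) : K →L[ℂ] K) w⟫_ℂ
      = ⟪(f x : K →L[ℂ] K) v, (f y : K →L[ℂ] K) w⟫_ℂ := by
  rw [map_mul, map_star]
  exact inner_star_mul _ _ v w

/-- The functional calculus keeps the square root inside the commutant of anything commuting with
`G`. This splits a positive intertwiner into two equal halves. -/
theorem exists_sqrt_commute {F : Type*} [NormedAddCommGroup F] [InnerProductSpace ℂ F]
    [CompleteSpace F] {G : F →L[ℂ] F} (hG : G.IsPositive) :
    ∃ Q : F →L[ℂ] F, Q * Q = G ∧ star Q = Q ∧ ∀ T : F →L[ℂ] F, Commute G T → Commute Q T := by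
  have hG' : 0 ≤ G := (ContinuousLinearMap.nonneg_iff_isPositive G).mpr hG
  exact ⟨CFC.sqrt G, CFC.sqrt_mul_sqrt_self G hG',
    (IsSelfAdjoint.of_nonneg (CFC.sqrt_nonneg G)).star_eq, fun T hT => hT.cfcₙ_nnreal _⟩

/-- A vector functional of a representation dominated by a vector functional of a second one is a
vector functional of the second one. -/
theorem exists_vector_of_norm_le {R F : Type*} [Ring R] [StarRing R] [Algebra ℂ R]
    [NormedAddCommGroup F] [InnerProductSpace ℂ F] [CompleteSpace F]
    (D : R →⋆ₐ[ℂ] (F →L[ℂ] F)) (f : R →⋆ₐ[ℂ] (K →L[ℂ] K)) (κ : F) (ξ : K)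
    (h : ∀ x, ‖f x ξ‖ ≤ ‖D x κ‖) : ∃ ζ : F, ∀ x, ⟪ξ, f x ξ⟫_ℂ = ⟪ζ, D x ζ⟫_ℂ := by
  let A : R →ₗ[ℂ] F :=
    { toFun := fun x => D x κ
      map_add' := fun x y => by simp
      map_smul' := fun c x => by simp }
  let B : R →ₗ[ℂ] K :=
    { toFun := fun x => f x ξ
      map_add' := fun x y => by simp
      map_smul' := fun c x => by simp }
  obtain ⟨T, hT, hT₀⟩ := exists_clm_comp_eq A B h
  have hDA : ∀ x y, D y (A x) = A (y * x) := fun x y => by simp [A]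
  have hfB : ∀ x y, f y (B x) = B (y * x) := fun x y => by simp [B]
  -- On the cyclic subspace of `κ` this is multiplicativity. On its complement `T` vanishes, and the
  -- complement is invariant under `D y` because the representation is star-closed.
  have hinter : ∀ y, T ∘L D y = f y ∘L T := by
    intro y
    ext1 v
    let U := (LinearMap.range A).topologicalClosure
    have : CompleteSpace U := (Submodule.isClosed_topologicalClosure _).completeSpace_coe
    have hU : ∀ u ∈ U, T (D y u) = f y (T u) := by
      intro u hu
      have hc : IsClosed {u | T (D y u) = f y (T u)} := isClosed_eq (by fun_prop) (by fun_prop)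
      refine closure_minimal ?_ hc hu
      rintro _ ⟨x, rfl⟩
      change T (D y (A x)) = f y (T (A x))
      rw [hDA, hT, hT, hfB]
    have hUo : ∀ u ∈ Uᗮ, T (D y u) = f y (T u) := by
      intro u hu
      have hu' : u ∈ (LinearMap.range A)ᗮ := by rwa [Submodule.orthogonal_closure] at hu
      rw [hT₀ u hu', map_zero]
      refine hT₀ _ ?_
      rw [Submodule.mem_orthogonal]
      rintro _ ⟨x, rfl⟩
      rw [← ContinuousLinearMap.adjoint_inner_left, ← ContinuousLinearMap.star_eq_adjoint,
        ← map_star, hDA]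
      exact (Submodule.mem_orthogonal _ _).mp hu' _ ⟨_, rfl⟩
    rw [← U.starProjection_add_starProjection_orthogonal v]
    simp only [ContinuousLinearMap.comp_apply, map_add]
    rw [hU _ (Submodule.starProjection_apply_mem _ _),
      hUo _ (Submodule.starProjection_apply_mem _ _)]
  have hinter' : ∀ y, D y ∘L ContinuousLinearMap.adjoint T = ContinuousLinearMap.adjoint T ∘L f y := by
    intro y
    have h₁ := congrArg ContinuousLinearMap.adjoint (hinter (star y))
    rwa [ContinuousLinearMap.adjoint_comp, ContinuousLinearMap.adjoint_comp,
      ← ContinuousLinearMap.star_eq_adjoint (D (star y)), ← map_star, star_star,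
      ← ContinuousLinearMap.star_eq_adjoint (f (star y)), ← map_star, star_star] at h₁
  obtain ⟨Q, hQQ, hQsa, hQc⟩ := exists_sqrt_commute
    (ContinuousLinearMap.isPositive_adjoint_comp_self T)
  have hQD : ∀ y, Commute Q (D y) := fun y => hQc _ (by
    change (ContinuousLinearMap.adjoint T ∘L T) ∘L D y
      = D y ∘L (ContinuousLinearMap.adjoint T ∘L T)
    rw [ContinuousLinearMap.comp_assoc, hinter, ← ContinuousLinearMap.comp_assoc, ← hinter',
      ContinuousLinearMap.comp_assoc])
  -- Here ⟪ξ, f x ξ⟫ = ⟪T κ, T (D x κ)⟫ = ⟪κ, Q² (D x κ)⟫, and one factor `Q` moves to each side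
  -- since `Q` commutes with `D x`.
  refine ⟨Q κ, fun x => ?_⟩
  have e₁ : D x (Q κ) = Q (D x κ) := (DFunLike.congr_fun (hQD x).eq κ).symm
  have e₂ : f x ξ = T (A x) := (hT x).symm
  have e₃ : T κ = ξ := by simpa [A, B] using hT 1
  rw [e₁, ← inner_star_mul, hQsa, hQQ, e₂, ContinuousLinearMap.comp_apply,
    ContinuousLinearMap.adjoint_inner_right, e₃]
  rfl

/-- By polarization the two sides differ by ‖(u − v)/2‖². -/
theorem re_inner_le_norm_half_add_sq {F : Type*} [NormedAddCommGroup F] [InnerProductSpace ℂ F]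
    (u v : F) : RCLike.re ⟪u, v⟫_ℂ ≤ ‖(2⁻¹ : ℂ) • (u + v)‖ ^ 2 := by
  have h₁ := @norm_add_sq ℂ _ _ _ _ u v
  have h₂ := @norm_sub_sq ℂ _ _ _ _ u v
  have h₃ := sq_nonneg ‖u - v‖
  have h₄ : ‖(2⁻¹ : ℂ)‖ ^ 2 = 1 / 4 := by norm_num
  rw [norm_smul, mul_pow, h₄]
  linarith

/-- A vector state composed with a normal homomorphism is a vector state of the amplification. -/
theorem IsWStarHom.exists_vector_state {f : Elt M →⋆ₐ[ℂ] Elt N} (hf : IsWStarHom f) (ξ : K) :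
    ∃ ζ : Ampl ℕ H, ∀ x : Elt M,
      ⟪ξ, (f x : K →L[ℂ] K) ξ⟫_ℂ = ⟪ζ, diag ℕ H (x : H →L[ℂ] H) ζ⟫_ℂ := by
  obtain ⟨α, β, hαβ⟩ := isUltraweak_iff.mp (isNormalMap_iff.mp hf (sgl 0 ξ) (sgl 0 ξ))
  have hφ : ∀ x : Elt M, ⟪ξ, (f x : K →L[ℂ] K) ξ⟫_ℂ = ⟪α, diag ℕ H (x : H →L[ℂ] H) β⟫_ℂ :=
    fun x => by
      rw [← hαβ, diag_single, lp.inner_single_left]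
      simp
  -- The functional is ⟪α, x β⟫ in the amplification, so ‖f x ξ‖² = ⟪x α, x β⟫. This is real, hence
  -- at most the squared norm of `x` applied to the half-sum of `α` and `β`, which serves as the
  -- dominating vector.
  refine exists_vector_of_norm_le ((diag ℕ H).comp M.toStarSubalgebra.subtype)
    (N.toStarSubalgebra.subtype.comp f) ((2⁻¹ : ℂ) • (α + β)) ξ fun x => ?_
  refine le_of_sq_le_sq ?_ (norm_nonneg _)
  change ‖(f x : K →L[ℂ] K) ξ‖ ^ 2 ≤ ‖diag ℕ H (x : H →L[ℂ] H) ((2⁻¹ : ℂ) • (α + β))‖ ^ 2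
  have h₁ : ⟪(f x : K →L[ℂ] K) ξ, (f x : K →L[ℂ] K) ξ⟫_ℂ
      = ⟪diag ℕ H (x : H →L[ℂ] H) α, diag ℕ H (x : H →L[ℂ] H) β⟫_ℂ := by
    rw [← inner_star_mul (diag ℕ H (x : H →L[ℂ] H)), ← map_star, ← map_mul]
    exact (inner_map_star_mul f x x ξ ξ).symm.trans (hφ (star x * x))
  rw [← @inner_self_eq_norm_sq ℂ, h₁, map_smul, map_add]
  exact re_inner_le_norm_half_add_sq _ _

/-- Every representation is a direct sum of cyclic representations. -/
theorem exists_cyclic_decomposition (f : Elt M →⋆ₐ[ℂ] Elt N) :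
    ∃ S : Set K, (S.Pairwise fun ξ ξ' => ∀ x : Elt M, ⟪ξ, (f x : K →L[ℂ] K) ξ'⟫_ℂ = 0) ∧
      (Submodule.span ℂ (Set.range fun p : S × Elt M =>
        (f p.2 : K →L[ℂ] K) (p.1 : K))).topologicalClosure = ⊤ := by
  let r : K → K → Prop := fun ξ ξ' => ∀ x : Elt M, ⟪ξ, (f x : K →L[ℂ] K) ξ'⟫_ℂ = 0
  obtain ⟨S, hS⟩ := zorn_subset {S : Set K | S.Pairwise r} fun c hc hchain =>
    ⟨⋃₀ c, (Set.pairwise_sUnion hchain.directedOn).mpr fun s hs => hc hs,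
      fun s hs => Set.subset_sUnion_of_mem hs⟩
  refine ⟨S, hS.prop, ?_⟩
  rw [Submodule.topologicalClosure_eq_top_iff, eq_bot_iff]
  intro η hη
  have h₁ : ∀ ξ ∈ S, r η ξ := fun ξ hξ x =>
    (Submodule.mem_orthogonal' _ _).mp hη _ (Submodule.subset_span ⟨(⟨ξ, hξ⟩, x), rfl⟩)
  have h₂ : ∀ ξ ∈ S, r ξ η := by
    intro ξ hξ x
    have h := inner_map_star_mul f (star x) 1 ξ η
    have h' := h₁ ξ hξ (star x)
    rw [star_star, mul_one] at h
    rw [h, ← inner_conj_symm]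
    simp [h']
  have hins : (insert η S).Pairwise r :=
    (Set.pairwise_insert).mpr ⟨hS.prop, fun ξ hξ _ => ⟨h₁ ξ hξ, h₂ ξ hξ⟩⟩
  -- A vector orthogonal to all the cyclic subspaces can be adjoined to `S`; by maximality it is
  -- already there, hence orthogonal to itself.
  have hmem : η ∈ S := hS.le_of_ge hins (Set.subset_insert η S) (Set.mem_insert η S)
  have h := h₁ η hmem 1
  simpa using h

/-- Extension by zero along an injection of the index sets. -/
def Ampl.extend {I J : Type*} (e : I → J) (he : Function.Injective e) (ξ : Ampl I H) :
    Ampl J H :=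
  ⟨Function.extend e ξ 0, by
    have h : (fun j => ‖Function.extend e ξ 0 j‖ ^ 2)
        = Function.extend e (fun i => ‖ξ i‖ ^ 2) 0 := by
      funext j
      by_cases hj : ∃ i, e i = j
      · obtain ⟨i, rfl⟩ := hj
        simp [he.extend_apply]
      · simp [Function.extend_apply' _ _ _ hj]
    refine memℓp_two_iff.mpr ?_
    rw [h, summable_extend_zero he]
    exact ξ.summable_norm_sq⟩

omit [CompleteSpace H] in
omit [InnerProductSpace ℂ H] in
theorem Ampl.extend_apply {I J : Type*} {e : I → J} (he : Function.Injective e) (ξ : Ampl I H)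
    (i : I) : Ampl.extend e he ξ (e i) = ξ i :=
  he.extend_apply _ _ i

omit [CompleteSpace H] in
omit [InnerProductSpace ℂ H] in
theorem Ampl.extend_apply' {I J : Type*} {e : I → J} (he : Function.Injective e) (ξ : Ampl I H)
    {j : J} (hj : ¬ ∃ i, e i = j) : Ampl.extend e he ξ j = 0 :=
  Function.extend_apply' _ _ _ hj

theorem Ampl.inner_extend_diag_extend {I J : Type*} {e : I → J} (he : Function.Injective e)
    (ξ η : Ampl I H) (x : H →L[ℂ] H) :
    ⟪ξ.extend e he, diag J H x (η.extend e he)⟫_ℂ = ⟪ξ, diag I H x η⟫_ℂ := by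
  refine (lp.hasSum_inner (ξ.extend e he) (diag J H x (η.extend e he))).unique ?_
  refine (he.hasSum_iff fun j hj => ?_).mp ?_
  · simp [Ampl.extend_apply' he ξ hj]
  · simpa [Function.comp_def, Ampl.extend_apply] using lp.hasSum_inner ξ (diag I H x η)

/-- A normal homomorphism is the compression of an amplification to an invariant subspace. -/
theorem IsWStarHom.exists_intertwiner {f : Elt M →⋆ₐ[ℂ] Elt N} (hf : IsWStarHom f) :
    ∃ (S : Set K) (V : K →ₗᵢ[ℂ] Ampl (S × ℕ) H), ∀ (x : Elt M) (v : K),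
      V ((f x : K →L[ℂ] K) v) = diag (S × ℕ) H (x : H →L[ℂ] H) (V v) := by
  obtain ⟨S, hS, htot⟩ := exists_cyclic_decomposition f
  choose ζ hζ using hf.exists_vector_state
  have hinj : ∀ ξ : S, Function.Injective (Prod.mk ξ : ℕ → S × ℕ) := fun ξ =>
    Prod.mk_right_injective ξ
  -- Each cyclic vector gets its own block of copies, so different cyclic parts stay orthogonal
  -- under the diagonal action.
  let c : S → Ampl (S × ℕ) H := fun ξ => (ζ ξ).extend (Prod.mk ξ) (hinj ξ)
  have horth : ∀ ξ ξ' : S, ξ ≠ ξ' → ∀ x : H →L[ℂ] H, ⟪c ξ, diag (S × ℕ) H x (c ξ')⟫_ℂ = 0 := by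
    intro ξ ξ' hne x
    rw [lp.inner_eq_tsum]
    convert tsum_zero with p
    obtain ⟨η, n⟩ := p
    by_cases hη : ξ = η
    · have h₁ : c ξ' (η, n) = 0 := Ampl.extend_apply' _ _ (by
        rintro ⟨m, hm⟩
        exact hne (hη.trans (congrArg Prod.fst hm).symm))
      simp [h₁]
    · have h₁ : c ξ (η, n) = 0 := Ampl.extend_apply' _ _ (by
        rintro ⟨m, hm⟩
        exact hη (congrArg Prod.fst hm))
      simp [h₁]
  let a : S × Elt M → K := fun p => (f p.2 : K →L[ℂ] K) (p.1 : K)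
  let b : S × Elt M → Ampl (S × ℕ) H := fun p => diag (S × ℕ) H (p.2 : H →L[ℂ] H) (c p.1)
  have hgram : ∀ p q, ⟪a p, a q⟫_ℂ = ⟪b p, b q⟫_ℂ := by
    rintro ⟨ξ, x⟩ ⟨ξ', y⟩
    have h₁ : ⟪a (ξ, x), a (ξ', y)⟫_ℂ = ⟪(ξ : K), (f (star x * y) : K →L[ℂ] K) ξ'⟫_ℂ :=
      (inner_map_star_mul f x y _ _).symm
    have h₂ : ⟪b (ξ, x), b (ξ', y)⟫_ℂ
        = ⟪c ξ, diag (S × ℕ) H ((star x * y : Elt M) : H →L[ℂ] H) (c ξ')⟫_ℂ := by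
      have := inner_star_mul (diag (S × ℕ) H (x : H →L[ℂ] H)) (diag (S × ℕ) H (y : H →L[ℂ] H))
        (c ξ) (c ξ')
      rw [← map_star, ← map_mul] at this
      exact this.symm
    rw [h₁, h₂]
    by_cases h : ξ = ξ'
    · subst h
      rw [Ampl.inner_extend_diag_extend, hζ]
    · rw [horth ξ ξ' h]
      exact hS ξ.2 ξ'.2 (fun h' => h (Subtype.ext h')) _
  obtain ⟨V, hV⟩ := exists_linearIsometry_of_inner_eq a b htot hgram
  refine ⟨S, V, fun x v => ?_⟩
  have hop : V.toContinuousLinearMap ∘L (f x : K →L[ℂ] K)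
      = diag (S × ℕ) H (x : H →L[ℂ] H) ∘L V.toContinuousLinearMap := by
    refine clm_ext_of_total htot ?_
    rintro ⟨ξ, y⟩
    have h₁ : (f x : K →L[ℂ] K) (a (ξ, y)) = a (ξ, x * y) := by simp [a]
    have h₂ : diag (S × ℕ) H (x : H →L[ℂ] H) (b (ξ, y)) = b (ξ, x * y) := by simp [b]
    change V ((f x : K →L[ℂ] K) (a (ξ, y))) = diag (S × ℕ) H (x : H →L[ℂ] H) (V (a (ξ, y)))
    rw [h₁, hV, hV, h₂]
  exact DFunLike.congr_fun hop v

end Spatial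

/-! ### Tensor products of normal homomorphisms with the identity -/

section Compression

variable {E F : Type*} [NormedAddCommGroup E] [InnerProductSpace ℂ E] [CompleteSpace E]
  [NormedAddCommGroup F] [InnerProductSpace ℂ F] [CompleteSpace F]

/-- The identification of an iterated Hilbert sum with a Hilbert sum over the product. -/
def Ampl.uncurry {I J : Type*} (ζ : Ampl I (Ampl J F)) : Ampl (I × J) F :=
  ⟨fun p => ζ p.1 p.2, memℓp_two_iff.mpr (by
    rw [summable_prod_of_nonneg fun p => by positivity]
    refine ⟨fun i => (ζ i).summable_norm_sq, ?_⟩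
    simpa only [← Ampl.norm_sq_eq] using memℓp_two_iff.mp (lp.memℓp ζ))⟩

theorem Ampl.inner_uncurry_diag_uncurry {I J : Type*} (ζ ζ' : Ampl I (Ampl J F))
    (x : F →L[ℂ] F) : ⟪ζ.uncurry, diag (I × J) F x ζ'.uncurry⟫_ℂ
      = ⟪ζ, diag I (Ampl J F) (diag J F x) ζ'⟫_ℂ :=
  (HasSum.prod_fiberwise (lp.hasSum_inner ζ.uncurry (diag (I × J) F x ζ'.uncurry))
    fun i => lp.hasSum_inner (ζ i) (diag J F x (ζ' i))).unique
    (lp.hasSum_inner ζ (diag I (Ampl J F) (diag J F x) ζ'))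

/-- A map intertwined with an amplification by an isometry is normal. -/
theorem isNormalMap_of_intertwiner {J : Type*} {M : VonNeumannAlgebra F}
    {f : Elt M → (E →L[ℂ] E)} (W : E →ₗᵢ[ℂ] Ampl J F)
    (hW : ∀ x v, W (f x v) = diag J F (x : F →L[ℂ] F) (W v)) : IsNormalMap M f := by
  rw [isNormalMap_iff]
  intro ξ η
  let W₁ : E →L[ℂ] Ampl J F := W.toContinuousLinearMap
  -- Applying `W` copy by copy turns a functional on ℕ copies of `E` into one on ℕ × J copies of
  -- `F`.
  have key := isUltraweak_inner_diag M (amplMap ℕ W₁ ξ).uncurry (amplMap ℕ W₁ η).uncurry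
  simp only [Ampl.inner_uncurry_diag_uncurry] at key
  have h : ∀ x : Elt M, ⟪ξ, diag ℕ E (f x) η⟫_ℂ
      = ⟪amplMap ℕ W₁ ξ, diag ℕ (Ampl J F) (diag J F (x : F →L[ℂ] F)) (amplMap ℕ W₁ η)⟫_ℂ := by
    intro x
    rw [lp.inner_eq_tsum, lp.inner_eq_tsum]
    refine tsum_congr fun n => ?_
    change ⟪ξ n, f x (η n)⟫_ℂ = ⟪W (ξ n), diag J F (x : F →L[ℂ] F) (W (η n))⟫_ℂ
    rw [← hW, W.inner_map_map]
  simpa only [h] using key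

/-- If the range of an isometry into an amplification reduces the generators, the compression of
the amplification is a normal homomorphism of the generated von Neumann algebra. -/
theorem exists_compression {J : Type*} (W : E →ₗᵢ[ℂ] Ampl J F) (s : Set (F →L[ℂ] F))
    (hW : ∀ g ∈ s, ∃ g' : E →L[ℂ] E, (∀ v, W (g' v) = diag J F g (W v)) ∧
      ∀ v, W (star g' v) = diag J F (star g) (W v)) :
    ∃ Φ : Elt (vnGen s) →⋆ₐ[ℂ] (E →L[ℂ] E),
      (∀ z v, W (Φ z v) = diag J F (z : F →L[ℂ] F) (W v)) ∧ IsNormalMap (vnGen s) Φ := by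
  classical
  let W₁ : E →L[ℂ] Ampl J F := W.toContinuousLinearMap
  let W₂ : Ampl J F →L[ℂ] E := ContinuousLinearMap.adjoint W₁
  have hiso : ∀ v, W₂ (W v) = v := fun v => by
    refine ext_inner_left ℂ fun w => ?_
    rw [ContinuousLinearMap.adjoint_inner_right]
    exact W.inner_map_map w v
  -- Intertwining both `g` and its adjoint makes the range of `W` reducing, so the range projection
  -- `W₁ ∘L W₂` commutes with the diagonal action.
  have hgen : ∀ (g : F →L[ℂ] F) (g' : E →L[ℂ] E), (∀ v, W (g' v) = diag J F g (W v)) →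
      (∀ v, W (star g' v) = diag J F (star g) (W v)) →
      (W₁ ∘L W₂) * diag J F g = diag J F g * (W₁ ∘L W₂) := by
    intro g g' h₁ h₂
    have e₁ : W₁ ∘L g' = diag J F g ∘L W₁ := ContinuousLinearMap.ext h₁
    have e₂ : W₁ ∘L star g' = diag J F (star g) ∘L W₁ := ContinuousLinearMap.ext h₂
    have e₃ := congrArg ContinuousLinearMap.adjoint e₂
    rw [ContinuousLinearMap.adjoint_comp, ContinuousLinearMap.adjoint_comp,
      ← ContinuousLinearMap.star_eq_adjoint (star g'), star_star,
      ← ContinuousLinearMap.star_eq_adjoint (diag J F (star g)), ← map_star, star_star] at e₃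
    change (W₁ ∘L W₂) ∘L diag J F g = diag J F g ∘L (W₁ ∘L W₂)
    rw [ContinuousLinearMap.comp_assoc, ← e₃, ← ContinuousLinearMap.comp_assoc, e₁,
      ContinuousLinearMap.comp_assoc]
  have hP : ∀ z : Elt (vnGen s),
      (W₁ ∘L W₂) * diag J F (z : F →L[ℂ] F) = diag J F (z : F →L[ℂ] F) * (W₁ ∘L W₂) := by
    intro z
    rw [commute_diag_iff]
    intro i j
    refine mem_vnGen_iff.mp z.2 _ (fun g hg => ?_) fun g hg => ?_
    · obtain ⟨g', h₁, h₂⟩ := hW g hg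
      exact commute_diag_iff.mp (hgen g g' h₁ h₂) i j
    · obtain ⟨g', h₁, h₂⟩ := hW g hg
      refine commute_diag_iff.mp (hgen (star g) (star g') h₂ fun v => ?_) i j
      rw [star_star, star_star]
      exact h₁ v
  let φ : Elt (vnGen s) → (E →L[ℂ] E) := fun z => W₂ ∘L diag J F (z : F →L[ℂ] F) ∘L W₁
  have hφ : ∀ z v, W (φ z v) = diag J F (z : F →L[ℂ] F) (W v) := by
    intro z v
    have h : W (W₂ (diag J F (z : F →L[ℂ] F) (W v)))
        = diag J F (z : F →L[ℂ] F) (W (W₂ (W v))) := DFunLike.congr_fun (hP z) (W v)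
    rw [hiso] at h
    exact h
  let Φ : Elt (vnGen s) →⋆ₐ[ℂ] (E →L[ℂ] E) :=
    { toFun := φ
      map_one' := by ext v; exact W.injective (by rw [hφ]; simp)
      map_mul' := fun z w => by
        ext v
        refine W.injective ?_
        change W (φ (z * w) v) = W (φ z (φ w v))
        rw [hφ, hφ, hφ]
        simp
      map_zero' := by ext v; exact W.injective (by rw [hφ]; simp)
      map_add' := fun z w => by
        ext v
        refine W.injective ?_
        rw [hφ, add_apply, map_add, hφ, hφ]
        simp
      commutes' := fun c => by
        ext v
        refine W.injective ?_
        rw [hφ]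
        simp [Algebra.algebraMap_eq_smul_one]
      map_star' := fun z => by
        have h : star (φ z) = W₂ ∘L star (diag J F (z : F →L[ℂ] F)) ∘L W₁ := by
          simp only [φ, W₂, ContinuousLinearMap.star_eq_adjoint, ContinuousLinearMap.adjoint_comp,
            ContinuousLinearMap.adjoint_adjoint, ContinuousLinearMap.comp_assoc]
        rw [h, ← map_star]
        rfl }
  exact ⟨Φ, hφ, isNormalMap_of_intertwiner W hφ⟩

end Compression

/-! ### Elementary tensors, tensored isometries and homomorphisms -/

section TensorHom

variable {H K L : Type*} [NormedAddCommGroup H] [InnerProductSpace ℂ H] [CompleteSpace H]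
  [NormedAddCommGroup K] [InnerProductSpace ℂ K] [CompleteSpace K]
  [NormedAddCommGroup L] [InnerProductSpace ℂ L] [CompleteSpace L]

/-- The elementary tensor `v ⊗ w` in the Hilbert space tensor product, linear in `v`. -/
def tmulL (H : Type*) [NormedAddCommGroup H] [InnerProductSpace ℂ H] (w : L) :
    H →L[ℂ] HTensor H L :=
  UniformSpace.Completion.toComplL ∘L ((TensorProduct.mkL ℂ H L).flip w)

omit [CompleteSpace H] [CompleteSpace L] in
theorem tmulL_apply (v : H) (w : L) : tmulL H w v = ((v ⊗ₜ[ℂ] w : H ⊗[ℂ] L) : HTensor H L) := rfl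

omit [CompleteSpace H] [CompleteSpace L] in
theorem inner_tmulL (v v' : H) (w w' : L) :
    ⟪tmulL H w v, tmulL H w' v'⟫_ℂ = ⟪v, v'⟫_ℂ * ⟪w, w'⟫_ℂ := by
  rw [tmulL_apply, tmulL_apply, UniformSpace.Completion.inner_coe, TensorProduct.inner_tmul]

omit [CompleteSpace H] [CompleteSpace L] in
theorem ampL_tmulL (x : H →L[ℂ] H) (v : H) (w : L) : ampL L x (tmulL H w v) = tmulL H w (x v) :=
  ampL_tmul x v w

omit [CompleteSpace H] [CompleteSpace L] in
theorem ampR_tmulL (y : L →L[ℂ] L) (v : H) (w : L) : ampR H y (tmulL H w v) = tmulL H (y w) v :=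
  ampR_tmul y v w

omit [CompleteSpace H] [CompleteSpace L] in
theorem tmulL_total : (Submodule.span ℂ (Set.range fun p : H × L =>
    tmulL H p.2 p.1)).topologicalClosure = ⊤ := by
  rw [← Submodule.dense_iff_topologicalClosure_eq_top]
  refine (UniformSpace.Completion.denseRange_coe (α := H ⊗[ℂ] L)).mono ?_
  rintro _ ⟨z, rfl⟩
  induction z with
  | zero => exact (UniformSpace.Completion.coe_zero (α := H ⊗[ℂ] L)) ▸ Submodule.zero_mem _
  | tmul v w => exact Submodule.subset_span ⟨(v, w), rfl⟩
  | add z₁ z₂ h₁ h₂ =>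
    rw [UniformSpace.Completion.coe_add]
    exact Submodule.add_mem _ h₁ h₂

omit [CompleteSpace H] [CompleteSpace L] in
theorem htensor_clm_ext {G : Type*} [NormedAddCommGroup G] [InnerProductSpace ℂ G]
    {S T : HTensor H L →L[ℂ] G} (h : ∀ v w, S (tmulL H w v) = T (tmulL H w v)) : S = T := by
  refine ContinuousLinearMap.ext_on
    (Submodule.dense_iff_topologicalClosure_eq_top.mpr tmulL_total) ?_
  rintro _ ⟨p, rfl⟩
  exact h p.1 p.2

omit [CompleteSpace H] [CompleteSpace L] in
theorem adjoint_eq_of_inner_tmulL {S T : HTensor H L →L[ℂ] HTensor H L}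
    (h : ∀ v w v' w', ⟪S (tmulL H w v), tmulL H w' v'⟫_ℂ = ⟪tmulL H w v, T (tmulL H w' v')⟫_ℂ) :
    star T = S := by
  rw [ContinuousLinearMap.star_eq_adjoint]
  refine htensor_clm_ext fun v w => ?_
  refine ext_inner_right ℂ fun u => ?_
  have key : innerSL ℂ (ContinuousLinearMap.adjoint T (tmulL H w v))
      = innerSL ℂ (S (tmulL H w v)) := htensor_clm_ext fun v' w' => by
    rw [innerSL_apply_apply, innerSL_apply_apply, ContinuousLinearMap.adjoint_inner_left, h]
  exact DFunLike.congr_fun key u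

omit [CompleteSpace L] in
theorem star_ampL (x : H →L[ℂ] H) : star (ampL L x) = ampL L (star x) :=
  adjoint_eq_of_inner_tmulL fun v w v' w' => by
    rw [ampL_tmulL, ampL_tmulL, inner_tmulL, inner_tmulL, ContinuousLinearMap.star_eq_adjoint,
      ContinuousLinearMap.adjoint_inner_left]

omit [CompleteSpace H] in
theorem star_ampR (y : L →L[ℂ] L) : star (ampR H y) = ampR H (star y) :=
  adjoint_eq_of_inner_tmulL fun v w v' w' => by
    rw [ampR_tmulL, ampR_tmulL, inner_tmulL, inner_tmulL, ContinuousLinearMap.star_eq_adjoint,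
      ContinuousLinearMap.adjoint_inner_left]

theorem vnTensor_le_vnGen (M : VonNeumannAlgebra H) (N : VonNeumannAlgebra L) :
    vnTensor M N ≤ vnGen ((↑) '' (Set.range (inl M N) ∪ Set.range (inr M N))) := by
  refine vnGen_mono ?_
  rintro _ (⟨x, hx, rfl⟩ | ⟨y, hy, rfl⟩)
  · exact ⟨inl M N ⟨x, hx⟩, Or.inl ⟨_, rfl⟩, rfl⟩
  · exact ⟨inr M N ⟨y, hy⟩, Or.inr ⟨_, rfl⟩, rfl⟩

/-- The tensor product of an isometry into a Hilbert sum with the identity. -/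
theorem exists_tensor_isometry {J : Type*} (V : K →ₗᵢ[ℂ] Ampl J H) :
    ∃ W : HTensor K L →ₗᵢ[ℂ] Ampl J (HTensor H L),
      ∀ v w, W (tmulL K w v) = amplMap J (tmulL H w) (V v) := by
  obtain ⟨W, hW⟩ := exists_linearIsometry_of_inner_eq (fun p : K × L => tmulL K p.2 p.1)
    (fun p : K × L => amplMap J (tmulL H p.2) (V p.1)) tmulL_total fun p q => by
      rw [inner_tmulL, ← V.inner_map_map, lp.inner_eq_tsum, lp.inner_eq_tsum, ← tsum_mul_right]
      exact tsum_congr fun j => (inner_tmulL _ _ _ _).symm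
  exact ⟨W, fun v w => hW (v, w)⟩

/-- The tensor product of a normal homomorphism with the identity. -/
theorem IsWStarHom.exists_tensor_id {M : VonNeumannAlgebra H} {N : VonNeumannAlgebra K}
    {f : Elt M →⋆ₐ[ℂ] Elt N} (hf : IsWStarHom f) (A : VonNeumannAlgebra L) :
    ∃ g : Elt (vnTensor M A) →⋆ₐ[ℂ] Elt (vnTensor N A), IsWStarHom g ∧
      (∀ x, g (inl M A x) = inl N A (f x)) ∧ ∀ a, g (inr M A a) = inr N A a := by
  obtain ⟨S, V, hV⟩ := hf.exists_intertwiner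
  obtain ⟨W, hW⟩ := exists_tensor_isometry (L := L) V
  have hL : ∀ (x : Elt M) (u : HTensor K L), W (ampL L (f x : K →L[ℂ] K) u)
      = diag (S × ℕ) (HTensor H L) (ampL L (x : H →L[ℂ] H)) (W u) := by
    intro x
    refine DFunLike.congr_fun (f := W.toContinuousLinearMap ∘L ampL L (f x : K →L[ℂ] K))
      (g := diag (S × ℕ) (HTensor H L) (ampL L (x : H →L[ℂ] H)) ∘L W.toContinuousLinearMap)
      (htensor_clm_ext fun v w => ?_)
    change W (ampL L (f x : K →L[ℂ] K) (tmulL K w v))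
      = diag (S × ℕ) (HTensor H L) (ampL L (x : H →L[ℂ] H)) (W (tmulL K w v))
    rw [ampL_tmulL, hW, hW, hV]
    ext j
    exact (ampL_tmulL _ _ _).symm
  have hR : ∀ (y : L →L[ℂ] L) (u : HTensor K L), W (ampR K y u)
      = diag (S × ℕ) (HTensor H L) (ampR H y) (W u) := by
    intro y
    refine DFunLike.congr_fun (f := W.toContinuousLinearMap ∘L ampR K y)
      (g := diag (S × ℕ) (HTensor H L) (ampR H y) ∘L W.toContinuousLinearMap)
      (htensor_clm_ext fun v w => ?_)
    change W (ampR K y (tmulL K w v))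
      = diag (S × ℕ) (HTensor H L) (ampR H y) (W (tmulL K w v))
    rw [ampR_tmulL, hW, hW]
    ext j
    exact (ampR_tmulL _ _ _).symm
  -- The operators `f x ⊗ 1` and `1 ⊗ y` are carried by `W` to the diagonal actions of the
  -- generators. Injectivity of `W` then forces `Φ` to take these values.
  obtain ⟨Φ, hΦ, hΦn⟩ := exists_compression W
    (ampL L '' (M : Set (H →L[ℂ] H)) ∪ ampR H '' (A : Set (L →L[ℂ] L))) (by
      rintro _ (⟨x, hx, rfl⟩ | ⟨y, hy, rfl⟩)
      · refine ⟨ampL L (f ⟨x, hx⟩ : K →L[ℂ] K), hL ⟨x, hx⟩, fun v => ?_⟩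
        have := hL (star ⟨x, hx⟩) v
        rw [star_ampL, star_ampL]
        rw [map_star] at this
        exact this
      · refine ⟨ampR K y, hR y, fun v => ?_⟩
        rw [star_ampR, star_ampR]
        exact hR _ v)
  have hl : ∀ x, Φ (inl M A x) = ampL L (f x : K →L[ℂ] K) := fun x => by
    ext1 u
    exact W.injective ((hΦ _ u).trans (hL x u).symm)
  have hr : ∀ a, Φ (inr M A a) = ampR K (a : L →L[ℂ] L) := fun a => by
    ext1 u
    exact W.injective ((hΦ _ u).trans (hR a u).symm)
  have hmem : ∀ z, Φ z ∈ (vnTensor N A).toStarSubalgebra := by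
    refine hΦn.apply_mem (vnTensor N A) _ (vnTensor_le_vnGen M A) ?_
    rintro _ (⟨x, rfl⟩ | ⟨y, rfl⟩)
    · rw [hl]
      exact (inl N A (f x)).2
    · rw [hr]
      exact (inr N A y).2
  exact ⟨Φ.codRestrict _ hmem, hΦn, fun x => Subtype.ext (hl x), fun a => Subtype.ext (hr a)⟩

/-- A Hilbert basis of `L` splits H ⊗ L into copies of `H`, sending v ⊗ w to the family (w_j v)_j,
and there x ⊗ 1 acts diagonally. -/
theorem isNormalMap_inl (M : VonNeumannAlgebra H) (A : VonNeumannAlgebra L) :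
    IsNormalMap M fun x => (inl M A x : HTensor H L →L[ℂ] HTensor H L) := by
  obtain ⟨ι, B, -⟩ := exists_hilbertBasis ℂ L
  let c : H × L → Ampl ι H := fun p =>
    amplMap ι (ContinuousLinearMap.toSpanSingleton ℂ p.1) (B.repr p.2)
  obtain ⟨W, hW⟩ := exists_linearIsometry_of_inner_eq (fun p : H × L => tmulL H p.2 p.1) c
    tmulL_total fun p q => by
      rw [inner_tmulL, ← B.repr.inner_map_map, lp.inner_eq_tsum, lp.inner_eq_tsum,
        ← tsum_mul_left]
      refine tsum_congr fun j => ?_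
      simp only [c, amplMap_apply, ContinuousLinearMap.toSpanSingleton_apply, inner_smul_left,
        inner_smul_right, RCLike.inner_apply]
      ring
  refine isNormalMap_of_intertwiner W fun x => ?_
  refine DFunLike.congr_fun (f := W.toContinuousLinearMap ∘L ampL L (x : H →L[ℂ] H))
    (g := diag ι H (x : H →L[ℂ] H) ∘L W.toContinuousLinearMap) (htensor_clm_ext fun v w => ?_)
  change W (ampL L (x : H →L[ℂ] H) (tmulL H w v)) = diag ι H (x : H →L[ℂ] H) (W (tmulL H w v))
  rw [ampL_tmulL, hW (x.1 v, w), hW (v, w)]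
  ext j
  simp [c]

/-- The embedding `x ↦ x ⊗ 1` as a star homomorphism. -/
def inlHom (M : VonNeumannAlgebra H) (A : VonNeumannAlgebra L) :
    Elt M →⋆ₐ[ℂ] Elt (vnTensor M A) where
  toFun := inl M A
  map_one' := Subtype.ext (htensor_clm_ext fun v w => ampL_tmulL _ v w)
  map_mul' x y := Subtype.ext (htensor_clm_ext fun v w => by
    change ampL L (x * y : H →L[ℂ] H) (tmulL H w v)
      = ampL L (x : H →L[ℂ] H) (ampL L (y : H →L[ℂ] H) (tmulL H w v))
    simp only [ampL_tmulL]
    rfl)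
  map_zero' := Subtype.ext (htensor_clm_ext fun v w => by
    change ampL L (0 : H →L[ℂ] H) (tmulL H w v) = 0
    rw [ampL_tmulL]
    exact map_zero _)
  map_add' x y := Subtype.ext (htensor_clm_ext fun v w => by
    change ampL L (x + y : H →L[ℂ] H) (tmulL H w v)
      = ampL L (x : H →L[ℂ] H) (tmulL H w v) + ampL L (y : H →L[ℂ] H) (tmulL H w v)
    simp only [ampL_tmulL]
    exact map_add _ _ _)
  commutes' c := Subtype.ext (htensor_clm_ext fun v w => by
    change ampL L (algebraMap ℂ (H →L[ℂ] H) c) (tmulL H w v) = c • tmulL H w v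
    rw [ampL_tmulL]
    exact map_smul _ _ _)
  map_star' x := Subtype.ext (star_ampL (x : H →L[ℂ] H)).symm

end TensorHom

/-! ### `σ`-homomorphisms and normal maps -/

section SigmaHom

variable {H K : Type*} [NormedAddCommGroup H] [InnerProductSpace ℂ H] [CompleteSpace H]
  [NormedAddCommGroup K] [InnerProductSpace ℂ K] [CompleteSpace K]
  {Ω : Type*} {m : MeasurableSpace Ω} {E : Set Ω → (H →L[ℂ] H)}

theorem IsSigmaHom.mono {m' : MeasurableSpace Ω} (hE : IsSigmaHom m E) (h : m' ≤ m) :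
    IsSigmaHom m' E where
  isStarProjection Δ hΔ := hE.isStarProjection Δ (h _ hΔ)
  inter Δ Γ hΔ hΓ := hE.inter Δ Γ (h _ hΔ) (h _ hΓ)
  univ := hE.univ
  iUnion D hD := hE.iUnion D fun n => h _ (hD n)

theorem IsSigmaHom.empty (hE : IsSigmaHom m E) : E ∅ = 0 := by
  ext1 ψ
  have h := hE.iUnion (fun _ => ∅) (fun _ => MeasurableSet.empty)
    (fun _ _ _ => Set.disjoint_empty _) ψ
  simpa using h.summable.tendsto_atTop_zero

/-- Countable additivity is applied to the sequence Δ, Δᶜ, ∅, ∅, …. -/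
theorem IsSigmaHom.compl (hE : IsSigmaHom m E) {Δ : Set Ω} (hΔ : MeasurableSet[m] Δ) :
    E Δᶜ = 1 - E Δ := by
  let D : ℕ → Set Ω := fun n => if n = 0 then Δ else if n = 1 then Δᶜ else ∅
  have hD : ∀ n, MeasurableSet[m] (D n) := by
    intro n
    simp only [D]
    split_ifs
    exacts [hΔ, hΔ.compl, MeasurableSet.empty]
  have hdisj : Pairwise (Function.onFun Disjoint D) := by
    intro i j hij
    simp only [Function.onFun, D]
    split_ifs <;> first | omega | simp [disjoint_compl_right, disjoint_compl_left]
  have hun : ⋃ n, D n = Set.univ := by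
    refine Set.eq_univ_of_forall fun ω => Set.mem_iUnion.mpr ?_
    by_cases hω : ω ∈ Δ
    · exact ⟨0, by simpa [D] using hω⟩
    · exact ⟨1, by simpa [D] using hω⟩
  ext1 ψ
  have h₁ := hE.iUnion D hD hdisj ψ
  have h₂ : HasSum (fun n => E (D n) ψ) (∑ n ∈ Finset.range 2, E (D n) ψ) := by
    refine hasSum_sum_of_ne_finset_zero fun n hn => ?_
    have hn' : 2 ≤ n := not_lt.mp (by simpa using hn)
    have h : D n = ∅ := by
      simp only [D]
      rw [if_neg (by omega), if_neg (by omega)]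
    rw [h, hE.empty]
    rfl
  have h₃ := h₁.unique h₂
  rw [hun, hE.univ, Finset.sum_range_succ, Finset.sum_range_one] at h₃
  simp only [D, if_true, one_ne_zero, if_false] at h₃
  rw [sub_apply, eq_sub_iff_add_eq, add_comm]
  exact h₃.symm

/-- If the values of a `σ`-homomorphism on a generating `π`-system belong to a von Neumann algebra,
then so do all its values. -/
theorem IsSigmaHom.mem_of_generateFrom (hE : IsSigmaHom m E) (N : VonNeumannAlgebra H)
    {s : Set (Set Ω)} (hm : m = MeasurableSpace.generateFrom s) (hs : IsPiSystem s)
    (h : ∀ Δ ∈ s, E Δ ∈ N) {Δ : Set Ω} (hΔ : MeasurableSet[m] Δ) : E Δ ∈ N := by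
  induction Δ, hΔ using MeasurableSpace.induction_on_inter hm hs with
  | empty => rw [hE.empty]; exact zero_mem N
  | basic Δ hΔ => exact h Δ hΔ
  | compl Δ hΔ ih =>
    rw [hE.compl hΔ]
    exact sub_mem (one_mem N) ih
  | iUnion D hdisj hD ih =>
    -- Commuting with an operator `y` of the commutant survives strong convergence of the series.
    rw [mem_iff_commutant]
    intro y hy
    ext1 ψ
    have h₁ := (hE.iUnion D hD hdisj ψ).mapL y
    have h₂ := hE.iUnion D hD hdisj (y ψ)
    have h₃ : ∀ n, y (E (D n) ψ) = E (D n) (y ψ) := fun n => DFunLike.congr_fun (hy _ (ih n)) ψ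
    simp only [h₃] at h₁
    exact h₁.unique h₂

theorem IsSigmaHom.mul_disjoint (hE : IsSigmaHom m E) {Δ Γ : Set Ω} (hΔ : MeasurableSet[m] Δ)
    (hΓ : MeasurableSet[m] Γ) (h : Disjoint Δ Γ) : E Δ * E Γ = 0 := by
  rw [← hE.inter Δ Γ hΔ hΓ, h.inter_eq, hE.empty]

theorem isStarProjection_sum {R ι : Type*} [Ring R] [StarRing R] (p : ι → R)
    (hp : ∀ i, IsStarProjection (p i)) (horth : Pairwise fun i j => p i * p j = 0)
    (F : Finset ι) : IsStarProjection (∑ i ∈ F, p i) := by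
  refine ⟨?_, ?_⟩
  · change (∑ i ∈ F, p i) * ∑ j ∈ F, p j = ∑ i ∈ F, p i
    rw [Finset.sum_mul_sum]
    refine Finset.sum_congr rfl fun i hi => ?_
    rw [Finset.sum_eq_single i (fun j _ hj => horth hj.symm) (fun h => absurd hi h)]
    exact (hp i).isIdempotentElem
  · change star (∑ i ∈ F, p i) = ∑ i ∈ F, p i
    rw [star_sum]
    exact Finset.sum_congr rfl fun i _ => (hp i).isSelfAdjoint

/-- Ultraweakly continuous functionals are continuous along bounded strongly convergent nets. -/
theorem IsUltraweak.tendsto {M : VonNeumannAlgebra H} {φ : Elt M → ℂ} (hφ : IsUltraweak M φ)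
    {ι : Type*} {l : Filter ι} {x : ι → Elt M} {y : Elt M}
    (hb : ∀ i, ‖(x i : H →L[ℂ] H)‖ ≤ 1)
    (hx : ∀ v, Filter.Tendsto (fun i => (x i : H →L[ℂ] H) v) l (nhds ((y : H →L[ℂ] H) v))) :
    Filter.Tendsto (fun i => φ (x i)) l (nhds (φ y)) := by
  obtain ⟨ξ, η, hξ, hη, h⟩ := hφ
  simp only [h]
  refine tendsto_tsum_of_dominated_convergence (bound := fun n => ‖ξ n‖ ^ 2 + ‖η n‖ ^ 2)
    (hξ.add hη) (fun n => Filter.Tendsto.inner tendsto_const_nhds (hx (η n)))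
    (Filter.Eventually.of_forall fun i n => ?_)
  have h₁ : ‖(x i : H →L[ℂ] H) (η n)‖ ≤ ‖η n‖ := by
    simpa using (x i : H →L[ℂ] H).le_of_opNorm_le (hb i) (η n)
  have h₂ : ‖⟪ξ n, (x i : H →L[ℂ] H) (η n)⟫_ℂ‖ ≤ ‖ξ n‖ * ‖η n‖ :=
    (norm_inner_le_norm _ _).trans (by gcongr)
  nlinarith [sq_nonneg (‖ξ n‖ - ‖η n‖), sq_nonneg ‖ξ n‖, sq_nonneg ‖η n‖]

/-- A normal homomorphism maps `σ`-homomorphisms to `σ`-homomorphisms. -/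
theorem IsWStarHom.isSigmaHom {M : VonNeumannAlgebra H} {N : VonNeumannAlgebra K}
    {f : Elt M →⋆ₐ[ℂ] Elt N} (hf : IsWStarHom f) (hE : IsSigmaHom m E)
    {P : Set Ω → Elt M} (hP : ∀ Δ, MeasurableSet[m] Δ → (P Δ : H →L[ℂ] H) = E Δ)
    {Q : Set Ω → Elt N} (hQ : ∀ Δ, MeasurableSet[m] Δ → Q Δ = f (P Δ)) :
    IsSigmaHom m fun Δ => (Q Δ : K →L[ℂ] K) := by
  have hPinter : ∀ Δ Γ, MeasurableSet[m] Δ → MeasurableSet[m] Γ → P (Δ ∩ Γ) = P Δ * P Γ :=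
    fun Δ Γ hΔ hΓ => Subtype.ext (by
      rw [hP _ (hΔ.inter hΓ), hE.inter Δ Γ hΔ hΓ]
      exact congrArg₂ _ (hP _ hΔ).symm (hP _ hΓ).symm)
  have hPproj : ∀ Δ, MeasurableSet[m] Δ → IsStarProjection (P Δ) := fun Δ hΔ => by
    have h := hE.isStarProjection Δ hΔ
    rw [← hP Δ hΔ] at h
    exact ⟨Subtype.ext h.isIdempotentElem, Subtype.ext h.isSelfAdjoint⟩
  refine ⟨fun Δ hΔ => ?_, fun Δ Γ hΔ hΓ => ?_, ?_, fun D hD hdisj ψ => ?_⟩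
  · rw [hQ Δ hΔ]
    exact ((hPproj Δ hΔ).map f).map N.toStarSubalgebra.subtype
  · rw [hQ _ (hΔ.inter hΓ), hPinter Δ Γ hΔ hΓ, map_mul, hQ Δ hΔ, hQ Γ hΓ]
    rfl
  · have h : P Set.univ = 1 := Subtype.ext ((hP _ MeasurableSet.univ).trans hE.univ)
    rw [hQ _ MeasurableSet.univ, h, map_one]
    rfl
  · have hU : MeasurableSet[m] (⋃ n, D n) := MeasurableSet.iUnion hD
    let p : ℕ → Elt M := fun n => P (D n)
    let u : Elt M := P (⋃ n, D n)
    let S : Finset ℕ → Elt M := fun F => ∑ n ∈ F, p n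
    have horth : Pairwise fun i j => p i * p j = 0 := fun i j hij => by
      refine Subtype.ext ?_
      change (P (D i) : H →L[ℂ] H) * (P (D j) : H →L[ℂ] H) = 0
      rw [hP _ (hD i), hP _ (hD j), hE.mul_disjoint (hD i) (hD j) (hdisj hij)]
    have hS : ∀ F, IsStarProjection (S F) :=
      isStarProjection_sum p (fun n => hPproj _ (hD n)) horth
    have hu : IsStarProjection u := hPproj _ hU
    have hup : ∀ n, u * p n = p n := fun n => by
      rw [← hPinter _ _ hU (hD n), Set.inter_eq_right.mpr (Set.subset_iUnion D n)]
    have huS : ∀ F, u * S F = S F := fun F => by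
      simp only [S, Finset.mul_sum, hup]
    have hSu : ∀ F, S F * u = S F := fun F => by
      have h := congrArg star (huS F)
      rwa [star_mul, (hS F).isSelfAdjoint.star_eq, hu.isSelfAdjoint.star_eq] at h
    -- Since the defect of a partial sum is a projection, the squared norm of its image on `ψ` is a
    -- vector functional. Ultraweak convergence under `f` is thus upgraded to strong convergence.
    have hdiff : ∀ F, star (S F - u) * (S F - u) = u - S F := fun F => by
      rw [star_sub, (hS F).isSelfAdjoint.star_eq, hu.isSelfAdjoint.star_eq, sub_mul, mul_sub,
        mul_sub, hSu, huS, (hS F).isIdempotentElem.eq, hu.isIdempotentElem.eq]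
      abel
    have hb : ∀ F, ‖(S F : H →L[ℂ] H)‖ ≤ 1 := fun F =>
      IsStarProjection.norm_le _ ((hS F).map M.toStarSubalgebra.subtype)
    have hstrong : ∀ v, Filter.Tendsto (fun F => (S F : H →L[ℂ] H) v) Filter.atTop
        (nhds ((u : H →L[ℂ] H) v)) := fun v => by
      have h := hE.iUnion D hD hdisj v
      rw [← hP _ hU] at h
      refine Filter.Tendsto.congr (fun F => ?_) h
      simp [S, p, hP _ (hD _)]
    have hφ := isNormalMap_iff.mp hf (sgl 0 ψ) (sgl 0 ψ)
    have hlim := hφ.tendsto hb hstrong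
    simp only [diag_single, lp.inner_single_left, sgl, lp.single_apply_self] at hlim
    have hnorm : ∀ F, ‖(f (S F) : K →L[ℂ] K) ψ - (f u : K →L[ℂ] K) ψ‖ ^ 2
        = RCLike.re (⟪ψ, (f u : K →L[ℂ] K) ψ⟫_ℂ - ⟪ψ, (f (S F) : K →L[ℂ] K) ψ⟫_ℂ) := fun F => by
      have h := inner_map_star_mul f (S F - u) (S F - u) ψ ψ
      rw [hdiff] at h
      rw [← @inner_self_eq_norm_sq ℂ, ← inner_sub_right]
      rw [map_sub, map_sub] at h
      exact congrArg RCLike.re h.symm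
    have hzero : Filter.Tendsto
        (fun F => ‖(f (S F) : K →L[ℂ] K) ψ - (f u : K →L[ℂ] K) ψ‖ ^ 2) Filter.atTop (nhds 0) := by
      simp only [hnorm]
      have h := (RCLike.continuous_re.tendsto _).comp (hlim.const_sub ⟪ψ, (f u : K →L[ℂ] K) ψ⟫_ℂ)
      simpa only [sub_self, map_zero, Function.comp_def] using h
    have hfin : Filter.Tendsto (fun F => (f (S F) : K →L[ℂ] K) ψ) Filter.atTop
        (nhds ((f u : K →L[ℂ] K) ψ)) := by
      rw [tendsto_iff_norm_sub_tendsto_zero]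
      simpa using hzero.sqrt
    change Filter.Tendsto _ _ _
    rw [hQ _ hU]
    refine Filter.Tendsto.congr (fun F => ?_) hfin
    simp [S, p, hQ _ (hD _)]

/-- A `σ`-homomorphism and a normal homomorphism which commute define a spectral transfer
measure. -/
theorem isSpectralTransferMeasure_mul {M : VonNeumannAlgebra H} {N P : VonNeumannAlgebra K}
    {Q : Set Ω → Elt N} (hQ : IsSigmaHom m fun Δ => (Q Δ : K →L[ℂ] K))
    {f : Elt M →⋆ₐ[ℂ] Elt N} (hf : IsWStarHom f)
    (hcomm : ∀ x Δ, MeasurableSet[m] Δ → Q Δ * f x = f x * Q Δ)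
    (hQP : ∀ Δ, MeasurableSet[m] Δ → (Q Δ : K →L[ℂ] K) ∈ P)
    (hfP : ∀ x, (f x : K →L[ℂ] K) ∈ P) :
    IsSpectralTransferMeasure m M P fun Δ x => ((Q Δ * f x : Elt N) : K →L[ℂ] K) where
  map_mem Δ hΔ x := mul_mem (hQP Δ hΔ) (hfP x)
  map_add Δ _ x y := by rw [map_add, mul_add]; rfl
  map_smul Δ _ c x := by rw [map_smul, mul_smul_comm]; rfl
  map_star Δ hΔ x := by
    have h : star (Q Δ) = Q Δ := Subtype.ext (hQ.isStarProjection Δ hΔ).isSelfAdjoint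
    have h' : Q Δ * f (star x) = star (Q Δ * f x) := by rw [star_mul, h, ← map_star, hcomm _ _ hΔ]
    exact congrArg Subtype.val h'
  inter_mul Δ Γ hΔ hΓ x y := by
    have h : Q (Δ ∩ Γ) = Q Δ * Q Γ := Subtype.ext (hQ.inter Δ Γ hΔ hΓ)
    have h' : Q (Δ ∩ Γ) * f (x * y) = Q Δ * f x * (Q Γ * f y) := by
      rw [h, map_mul, mul_assoc, mul_assoc, ← mul_assoc (Q Γ), hcomm x Γ hΓ, mul_assoc]
    exact congrArg Subtype.val h'
  normal Δ _ := IsNormalMap.const_mul hf (Q Δ : K →L[ℂ] K)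
  univ_one := by
    have h : Q Set.univ = 1 := Subtype.ext hQ.univ
    rw [h, map_one, one_mul]
    rfl
  iUnion D hD hdisj x ψ := hQ.iUnion D hD hdisj ((f x : K →L[ℂ] K) ψ)

end SigmaHom

/-! ### Product systems and open objects -/

section Product

variable {H K : Type*} [NormedAddCommGroup H] [InnerProductSpace ℂ H] [CompleteSpace H]
  [NormedAddCommGroup K] [InnerProductSpace ℂ K] [CompleteSpace K]

/-- The inclusion of von Neumann algebras. -/
def incl {M N : VonNeumannAlgebra H} (h : M ≤ N) : Elt M →⋆ₐ[ℂ] Elt N :=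
  StarSubalgebra.inclusion (S₁ := M.toStarSubalgebra) (S₂ := N.toStarSubalgebra) h

@[simp]
theorem coe_incl {M N : VonNeumannAlgebra H} (h : M ≤ N) (x : Elt M) :
    (incl h x : H →L[ℂ] H) = x := rfl

theorem incl_incl {M N P : VonNeumannAlgebra H} (h : M ≤ N) (h' : N ≤ P) (x : Elt M) :
    incl h' (incl h x) = incl (h.trans h') x := rfl

theorem incl_self {M : VonNeumannAlgebra H} (h : M ≤ M) (x : Elt M) : incl h x = x := rfl

theorem map_commute_of_coe {M : VonNeumannAlgebra H} {N : VonNeumannAlgebra K}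
    (f : Elt M →⋆ₐ[ℂ] Elt N) {x y : Elt M}
    (h : (x : H →L[ℂ] H) * (y : H →L[ℂ] H) = (y : H →L[ℂ] H) * (x : H →L[ℂ] H)) :
    f x * f y = f y * f x := by
  have h' : x * y = y * x := Subtype.ext h
  rw [← map_mul, h', map_mul]

theorem mul_map_mul {M : VonNeumannAlgebra H} {N : VonNeumannAlgebra K}
    (f : Elt M →⋆ₐ[ℂ] Elt N) (p : Elt N) (x y : Elt M) : p * f (x * y) = p * f x * f y := by
  rw [map_mul, mul_assoc]

theorem isWStarHom_incl {M N : VonNeumannAlgebra H} (h : M ≤ N) : IsWStarHom (incl h) :=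
  isNormalMap_coe M

theorem vnSup_le_vnGen (M N : VonNeumannAlgebra H) : vnSup M N ≤
    vnGen ((↑) '' (Set.range (incl (le_vnSup_left M N)) ∪ Set.range (incl (le_vnSup_right M N)) :
      Set (Elt (vnSup M N)))) := by
  refine vnGen_mono ?_
  rintro x (hx | hx)
  · exact ⟨incl (le_vnSup_left M N) ⟨x, hx⟩, Or.inl ⟨_, rfl⟩, rfl⟩
  · exact ⟨incl (le_vnSup_right M N) ⟨x, hx⟩, Or.inr ⟨_, rfl⟩, rfl⟩

/-- A normal homomorphism restricts to a homomorphism between von Neumann subalgebras if it maps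
generators of the first one into the second one. -/
theorem IsWStarHom.exists_restrict {M P : VonNeumannAlgebra H} {N : VonNeumannAlgebra K}
    {f : Elt M →⋆ₐ[ℂ] Elt N} (hf : IsWStarHom f) (hP : P ≤ M) (Q : VonNeumannAlgebra K)
    (s : Set (Elt P)) (hs : P ≤ vnGen ((↑) '' s))
    (h : ∀ a ∈ s, (f (incl hP a) : K →L[ℂ] K) ∈ Q) :
    ∃ g : Elt P →⋆ₐ[ℂ] Elt Q, IsWStarHom g ∧
      ∀ x, (g x : K →L[ℂ] K) = f (incl hP x) := by
  let g₀ : Elt P →⋆ₐ[ℂ] (K →L[ℂ] K) := N.toStarSubalgebra.subtype.comp (f.comp (incl hP))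
  have hg₀ : IsNormalMap P g₀ := hf.comp (isWStarHom_incl hP)
  have hm : ∀ x, g₀ x ∈ Q.toStarSubalgebra := hg₀.apply_mem Q s hs h
  exact ⟨g₀.codRestrict _ hm, hg₀, fun _ => rfl⟩

/-- In a W*-product of `M` and `A`, the algebra `N ∨ A` is a W*-product of `N` and `A` for every
von Neumann subalgebra `N` of `M`. -/
theorem IsWStarProduct.restrict {M A B N : VonNeumannAlgebra H} (h : IsWStarProduct M A B)
    (hN : N ≤ M) :
    ∃ (α : Elt (vnTensor N A) →⋆ₐ[ℂ] Elt (vnSup N A))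
      (β : Elt (vnSup N A) →⋆ₐ[ℂ] Elt (vnTensor N A)), IsWStarHom α ∧ IsWStarHom β ∧
      (∀ x, α (inl N A x) = incl (le_vnSup_left N A) x) ∧
      (∀ a, α (inr N A a) = incl (le_vnSup_right N A) a) ∧
      (∀ x, β (incl (le_vnSup_left N A) x) = inl N A x) ∧
      ∀ a, β (incl (le_vnSup_right N A) a) = inr N A a := by
  obtain ⟨θ, hθ, hθs, hl, hr⟩ := h
  have hMB : M ≤ B := fun x hx => by
    have := (θ (inl M A ⟨x, hx⟩)).2
    rwa [hl] at this
  have hAB : A ≤ B := fun x hx => by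
    have := (θ (inr M A ⟨x, hx⟩)).2
    rwa [hr] at this
  have hTle : vnTensor N A ≤ vnTensor M A := vnTensor_mono hN le_rfl
  have hSle : vnSup N A ≤ B := vnSup_le (hN.trans hMB) hAB
  let φ : Elt (vnTensor M A) →⋆ₐ[ℂ] Elt B := θ.toStarAlgHom
  let ψ : Elt B →⋆ₐ[ℂ] Elt (vnTensor M A) := θ.symm.toStarAlgHom
  have hψφ : ∀ z, ψ (φ z) = z := θ.symm_apply_apply
  have hφl : ∀ x : Elt M, φ (inl M A x) = incl hMB x := fun x => Subtype.ext (hl x)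
  have hφr : ∀ a : Elt A, φ (inr M A a) = incl hAB a := fun a => Subtype.ext (hr a)
  have hψl : ∀ x : Elt M, ψ (incl hMB x) = inl M A x := fun x => by rw [← hφl, hψφ]
  have hψr : ∀ a : Elt A, ψ (incl hAB a) = inr M A a := fun a => by rw [← hφr, hψφ]
  have hφ : IsWStarHom φ := hθ
  have hψ : IsWStarHom ψ := hθs
  clear_value φ ψ
  -- All the tensor products act on the same H ⊗ H, so the isomorphism and its inverse need only be
  -- restricted, and generators go to generators.
  have hαl : ∀ x : Elt N, (φ (incl hTle (inl N A x)) : H →L[ℂ] H) = x := fun x =>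
    congrArg Subtype.val (hφl (incl hN x))
  have hαr : ∀ a : Elt A, (φ (incl hTle (inr N A a)) : H →L[ℂ] H) = a := fun a =>
    congrArg Subtype.val (hφr a)
  have hβl : ∀ x : Elt N, (ψ (incl hSle (incl (le_vnSup_left N A) x)) :
      HTensor H H →L[ℂ] HTensor H H) = inl N A x := fun x =>
    congrArg Subtype.val (hψl (incl hN x))
  have hβr : ∀ a : Elt A, (ψ (incl hSle (incl (le_vnSup_right N A) a)) :
      HTensor H H →L[ℂ] HTensor H H) = inr N A a := fun a => congrArg Subtype.val (hψr a)
  obtain ⟨α, hα, hα'⟩ := hφ.exists_restrict hTle (vnSup N A) _ (vnTensor_le_vnGen N A) (by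
    rintro _ (⟨x, rfl⟩ | ⟨a, rfl⟩)
    · rw [hαl]
      exact le_vnSup_left N A x.2
    · rw [hαr]
      exact le_vnSup_right N A a.2)
  obtain ⟨β, hβ, hβ'⟩ := hψ.exists_restrict hSle (vnTensor N A) _ (vnSup_le_vnGen N A) (by
    rintro _ (⟨x, rfl⟩ | ⟨a, rfl⟩)
    · rw [hβl]
      exact (inl N A x).2
    · rw [hβr]
      exact (inr N A a).2)
  exact ⟨α, β, hα, hβ, fun x => Subtype.ext ((hα' _).trans (hαl x)),
    fun a => Subtype.ext ((hα' _).trans (hαr a)), fun x => Subtype.ext ((hβ' _).trans (hβl x)),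
    fun a => Subtype.ext ((hβ' _).trans (hβr a))⟩

/-- Representations and their right inverses extend to tensor products. -/
theorem IsWStarProduct.exists_extension {M A B N : VonNeumannAlgebra H} {b : VonNeumannAlgebra K}
    (h : IsWStarProduct M A B) (hN : N ≤ M) {rep : Elt b →⋆ₐ[ℂ] Elt N}
    {inj : Elt N →⋆ₐ[ℂ] Elt b} (hrep : IsWStarHom rep) (hinj : IsWStarHom inj) :
    ∃ (R : Elt (vnTensor b A) →⋆ₐ[ℂ] Elt (vnSup N A))
      (J : Elt (vnSup N A) →⋆ₐ[ℂ] Elt (vnTensor b A)), IsWStarHom R ∧ IsWStarHom J ∧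
      (∀ q, R (inl b A q) = incl (le_vnSup_left N A) (rep q)) ∧
      (∀ a, R (inr b A a) = incl (le_vnSup_right N A) a) ∧
      (∀ x, J (incl (le_vnSup_left N A) x) = inl b A (inj x)) ∧
      ∀ a, J (incl (le_vnSup_right N A) a) = inr b A a := by
  obtain ⟨α, β, hα, hβ, hαl, hαr, hβl, hβr⟩ := h.restrict hN
  obtain ⟨r, hr, hrl, hrr⟩ := hrep.exists_tensor_id A
  obtain ⟨j, hj, hjl, hjr⟩ := hinj.exists_tensor_id A
  -- Both maps factor through N ⊗ A: one represents and then multiplies out, the other splits and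
  -- then injects.
  refine ⟨α.comp r, j.comp β, hα.comp hr, hj.comp hβ, fun q => ?_, fun a => ?_, fun x => ?_,
    fun a => ?_⟩
  · rw [StarAlgHom.comp_apply, hrl, hαl]
  · rw [StarAlgHom.comp_apply, hrr, hαr]
  · rw [StarAlgHom.comp_apply, hβl, hjl]
  · rw [StarAlgHom.comp_apply, hβr, hjr]

theorem isWStarHom_id (M : VonNeumannAlgebra H) : IsWStarHom (StarAlgHom.id ℂ (Elt M)) :=
  isNormalMap_coe M

end Product

/-! ### Boundary-plus-noise algebras and the extended representations -/

section Dynamics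

variable {H : Type*} [NormedAddCommGroup H] [InnerProductSpace ℂ H] [CompleteSpace H]
  {Ω : Type*} [MeasurableSpace Ω] {S : TrajectorySystem H Ω}

theorem TrajectorySystem.noise_le (u v : ℝ≥0) : S.noise u v ≤ S.A u := fun _ hx => hx.1

theorem TrajectorySystem.E_incr_mem {u v : ℝ≥0} {Δ : Set Ω} (hΔ : MeasurableSet[S.incr u v] Δ) :
    S.E Δ ∈ S.Mincr u v :=
  ⟨subset_vnGen _ ⟨Δ, (MeasurableSpace.measurableSet_inf.mp hΔ).1, rfl⟩,
    subset_vnGen _ ⟨Δ, (MeasurableSpace.measurableSet_inf.mp hΔ).2, rfl⟩⟩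

theorem TrajectorySystem.fut_eq_generateFrom (t : ℝ≥0) : S.fut t
    = MeasurableSpace.generateFrom {Δ | ∃ v, t < v ∧ MeasurableSet[S.incr t v] Δ} := by
  refine le_antisymm ?_ ?_
  · conv_lhs => rw [S.fut_eq t]
    exact iSup_le fun v => iSup_le fun hv Δ hΔ =>
      MeasurableSpace.measurableSet_generateFrom ⟨v, hv, hΔ⟩
  · refine MeasurableSpace.generateFrom_le ?_
    rintro Δ ⟨v, -, hΔ⟩
    exact (MeasurableSpace.measurableSet_inf.mp hΔ).1

/-- Histories increase, so two intervals starting at `t` fit into the longer one. -/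
theorem TrajectorySystem.isPiSystem_incr (t : ℝ≥0) :
    IsPiSystem {Δ | ∃ v, t < v ∧ MeasurableSet[S.incr t v] Δ} := by
  rintro Δ ⟨v, hv, hΔ⟩ Γ ⟨w, -, hΓ⟩ -
  exact ⟨max v w, lt_max_of_lt_left hv, MeasurableSet.inter
    ((inf_le_inf_left _ (S.past_mono (le_max_left v w))) _ hΔ)
    ((inf_le_inf_left _ (S.past_mono (le_max_right v w))) _ hΓ)⟩

theorem TrajectorySystem.incr_inter {u v w : ℝ≥0} (h : u ≤ v) (h' : v ≤ w) {Δ Γ : Set Ω}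
    (hΔ : MeasurableSet[S.incr u v] Δ) (hΓ : MeasurableSet[S.incr v w] Γ) :
    MeasurableSet[S.incr u w] (Δ ∩ Γ) :=
  MeasurableSet.inter ((inf_le_inf_left _ (S.past_mono h')) _ hΔ)
    ((inf_le_inf_right _ (S.fut_anti h)) _ hΓ)

namespace OpenObject

variable {K : ℝ≥0 → Type*} [∀ t, NormedAddCommGroup (K t)] [∀ t, InnerProductSpace ℂ (K t)]
  [∀ t, CompleteSpace (K t)] {O : OpenObject S K}

/-- The algebra generated by the boundary algebra and the future noise. -/
abbrev bdryNoise (O : OpenObject S K) (t : ℝ≥0) : VonNeumannAlgebra H := vnSup (O.bdry t) (S.A t)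

theorem IsDynamical.E_incr_mem (hO : O.IsDynamical) {u v : ℝ≥0} (h : u < v) {Δ : Set Ω}
    (hΔ : MeasurableSet[S.incr u v] Δ) : S.E Δ ∈ vnSup (O.bdry u) (S.noise u v) :=
  hO u v h (le_vnSup_left _ _ (S.E_incr_mem hΔ))

theorem vnSup_noise_le (O : OpenObject S K) (u v : ℝ≥0) :
    vnSup (O.bdry u) (S.noise u v) ≤ O.bdryNoise u :=
  vnSup_le (le_vnSup_left _ _) ((S.noise_le u v).trans (le_vnSup_right _ _))

/-- Dynamicality speaks of bounded intervals only; their events form a generating π-system, which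
settles unbounded ones. -/
theorem IsDynamical.E_fut_mem (hO : O.IsDynamical) {t : ℝ≥0} {Δ : Set Ω}
    (hΔ : MeasurableSet[S.fut t] Δ) : S.E Δ ∈ O.bdryNoise t :=
  (S.sigmaHom.mono (S.fut_le t)).mem_of_generateFrom (O.bdryNoise t) (S.fut_eq_generateFrom t)
    (S.isPiSystem_incr t)
    (fun _ ⟨v, hv, hΔ⟩ => O.vnSup_noise_le t v (hO.E_incr_mem hv hΔ)) hΔ

/-- Dynamicality handles the later boundary, and the decrease of `A` handles the noise. The flow is
built on this inclusion. -/
theorem IsDynamical.bdryNoise_anti (hO : O.IsDynamical) {u v : ℝ≥0} (h : u ≤ v) :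
    O.bdryNoise v ≤ O.bdryNoise u := by
  rcases h.eq_or_lt with rfl | h
  · exact le_rfl
  · exact vnSup_le (((le_vnSup_right _ _).trans (hO u v h)).trans (O.vnSup_noise_le u v))
      ((S.A_anti h.le).trans (le_vnSup_right _ _))

/-- This is the source of causality, because `S.Bfut t` commutes with the histories up to `t`. -/
theorem bdryNoise_le_Bfut (O : OpenObject S K) (t : ℝ≥0) : O.bdryNoise t ≤ S.Bfut t :=
  vnSup_le (fun _ hx => (O.bdry_le t hx).2) (S.A_le t)

/-- Extended representations together with extended injections. -/
structure IsExtension (O : OpenObject S K) (t : ℝ≥0)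
    (R : Elt (O.ext t) →⋆ₐ[ℂ] Elt (O.bdryNoise t))
    (J : Elt (O.bdryNoise t) →⋆ₐ[ℂ] Elt (O.ext t)) : Prop where
  normal : IsWStarHom R
  normal_inj : IsWStarHom J
  apply_inl : ∀ q, R (inl (O.b t) (S.A t) q) = incl (le_vnSup_left _ _) (O.rep t q)
  apply_inr : ∀ a, R (inr (O.b t) (S.A t) a) = incl (le_vnSup_right _ _) a
  inj_left : ∀ x, J (incl (le_vnSup_left _ _) x) = inl (O.b t) (S.A t) (O.inj t x)
  inj_right : ∀ a, J (incl (le_vnSup_right _ _) a) = inr (O.b t) (S.A t) a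

theorem exists_isExtension (hS : S.IsProductSystem) (O : OpenObject S K) (t : ℝ≥0) :
    ∃ R J, O.IsExtension t R J := by
  obtain ⟨R, J, h₁, h₂, h₃, h₄, h₅, h₆⟩ := (hS.properties_top t).exists_extension
    (fun x hx => (O.bdry_le t hx).1) (O.rep_normal t) (O.inj_normal t)
  exact ⟨R, J, h₁, h₂, h₃, h₄, h₅, h₆⟩

namespace IsExtension

variable {t : ℝ≥0} {R : Elt (O.ext t) →⋆ₐ[ℂ] Elt (O.bdryNoise t)}
  {J : Elt (O.bdryNoise t) →⋆ₐ[ℂ] Elt (O.ext t)}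

/-- On generators this reduces to `O.rep_inj`, and normality spreads it. The algebraic identities of
the flow rest on this cancellation. -/
theorem rep_inj (h : O.IsExtension t R J) (x : Elt (O.bdryNoise t)) : R (J x) = x := by
  have heq : R.comp J = StarAlgHom.id ℂ _ := by
    refine starAlgHom_ext_of_normal (h.normal.comp h.normal_inj) (isWStarHom_id _) _
      (vnSup_le_vnGen _ _) ?_
    rintro _ (⟨x, rfl⟩ | ⟨a, rfl⟩)
    · rw [StarAlgHom.comp_apply, h.inj_left, h.apply_inl, O.rep_inj]
      rfl
    · rw [StarAlgHom.comp_apply, h.inj_right, h.apply_inr]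
      rfl
  exact DFunLike.congr_fun heq x

/-- Surjectivity brings every generator q ⊗ 1 into the image of the injection, where the
representation can be undone. -/
theorem inj_rep (h : O.IsExtension t R J) (hs : Function.Surjective (O.inj t))
    (z : Elt (O.ext t)) : J (R z) = z := by
  have heq : J.comp R = StarAlgHom.id ℂ _ := by
    refine starAlgHom_ext_of_normal (h.normal_inj.comp h.normal) (isWStarHom_id _) _
      (vnTensor_le_vnGen _ _) ?_
    rintro _ (⟨q, rfl⟩ | ⟨a, rfl⟩)
    · obtain ⟨x, rfl⟩ := hs q
      rw [StarAlgHom.comp_apply, h.apply_inl, O.rep_inj, h.inj_left]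
      rfl
    · rw [StarAlgHom.comp_apply, h.apply_inr, h.inj_right]
      rfl
  exact DFunLike.congr_fun heq z

/-- Boundary and interval noise generators go to generators of the smaller tensor product, and
normality does the rest. Adaptedness of both the events and the flow comes from here. -/
theorem inj_mem_extIncr (h : O.IsExtension t R J) (v : ℝ≥0) (x : Elt (O.bdryNoise t))
    (hx : (x : H →L[ℂ] H) ∈ vnSup (O.bdry t) (S.noise t v)) :
    (J x : HTensor (K t) H →L[ℂ] HTensor (K t) H) ∈ O.extIncr t v := by
  obtain ⟨g, -, hg⟩ := h.normal_inj.exists_restrict (O.vnSup_noise_le t v) (O.extIncr t v) _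
    (vnSup_le_vnGen _ _) (by
      rintro _ (⟨y, rfl⟩ | ⟨a, rfl⟩)
      · have e := congrArg Subtype.val (h.inj_left y)
        exact e ▸ (inl (O.b t) (S.noise t v) (O.inj t y)).2
      · have e := congrArg Subtype.val (h.inj_right (incl (S.noise_le t v) a))
        exact e ▸ (inr (O.b t) (S.noise t v) a).2)
  have e : (g ⟨x, hx⟩ : HTensor (K t) H →L[ℂ] HTensor (K t) H) = J x := hg ⟨x, hx⟩
  exact e ▸ (g ⟨x, hx⟩).2

end IsExtension

end OpenObject

end Dynamics

end

end Eventum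

/-! ### Construction of the events, the flow and the transfer measures -/

open Eventum in
theorem mainTheorem8
    {H : Type*} [NormedAddCommGroup H] [InnerProductSpace ℂ H] [CompleteSpace H]
    {Ω : Type*} [MeasurableSpace Ω] (S : Eventum.TrajectorySystem H Ω)
    {K : ℝ≥0 → Type*} [∀ t, NormedAddCommGroup (K t)] [∀ t, InnerProductSpace ℂ (K t)]
    [∀ t, CompleteSpace (K t)] (O : Eventum.OpenObject S K)
    (hS : S.IsProductSystem) (hO : O.IsDynamical) :
    ∃ (R : ∀ t, Eventum.Elt (O.ext t) →⋆ₐ[ℂ] Eventum.Elt (Eventum.vnSup (O.bdry t) (S.A t)))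
      (Et : ∀ t, Set Ω → Eventum.Elt (O.ext t))
      (γ : ∀ u v, u ≤ v → (Eventum.Elt (O.ext v) →⋆ₐ[ℂ] Eventum.Elt (O.ext u))),
      -- the trivial extensions of the representations, the events and the flow
      O.IsExtendedRep R ∧
      O.IsAdaptedEvents Et ∧
      O.IsCausalFlow Et γ ∧
      -- the flow is the identity at coinciding times if the injection is onto
      (∀ t, Function.Surjective (O.inj t) → ∀ x, γ t t le_rfl x = x) ∧
      -- the flow preserves the events
      (∀ u v (h : u ≤ v) (Δ), MeasurableSet[S.fut v] Δ → γ u v h (Et v Δ) = Et u Δ) ∧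
      -- the given events and representations are recovered
      (∀ t Δ, MeasurableSet[S.fut t] Δ → (R t (Et t Δ) : H →L[ℂ] H) = S.E Δ) ∧
      (∀ u v (h : u ≤ v) (x), (R u (γ u v h x) : H →L[ℂ] H) = R v x) ∧
      -- the transitional measures are spectral transfer measures
      (∀ u v (h : u < v), Eventum.IsSpectralTransferMeasure (S.incr u v) (O.b v) (O.extIncr u v)
        (fun Δ q => (O.transition Et γ u v h.le Δ (Eventum.inl (O.b v) (S.A v) q) :
          Eventum.HTensor (K u) H →L[ℂ] Eventum.HTensor (K u) H))) ∧
      -- the hemigroup composition law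
      (∀ u v w (h : u < v) (h' : v < w) (Δ Γ), MeasurableSet[S.incr u v] Δ →
        MeasurableSet[S.incr v w] Γ → MeasurableSet[S.incr u w] (Δ ∩ Γ) ∧
        ∀ x, O.transition Et γ u v h.le Δ (O.transition Et γ v w h'.le Γ x)
          = O.transition Et γ u w (h.trans h').le (Δ ∩ Γ) x) := by
  classical
  choose R J hRJ using fun t => OpenObject.exists_isExtension hS O t
  -- The default value 0 is never taken on future events of `t`, whose projections lie in the
  -- algebra.
  let P : ∀ t, Set Ω → Elt (O.bdryNoise t) := fun t Δ =>
    if h : S.E Δ ∈ O.bdryNoise t then ⟨S.E Δ, h⟩ else 0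
  have hP : ∀ t Δ, MeasurableSet[S.fut t] Δ → (P t Δ : H →L[ℂ] H) = S.E Δ := fun t Δ hΔ => by
    simp only [P, dif_pos (hO.E_fut_mem hΔ)]
  clear_value P
  let Et : ∀ t, Set Ω → Elt (O.ext t) := fun t Δ => J t (P t Δ)
  have hEt : ∀ t Δ, Et t Δ = J t (P t Δ) := fun _ _ => rfl
  clear_value Et
  let γ : ∀ u v, u ≤ v → (Elt (O.ext v) →⋆ₐ[ℂ] Elt (O.ext u)) := fun u v h =>
    (J u).comp ((incl (hO.bdryNoise_anti h)).comp (R v))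
  have hγ : ∀ u v h x, γ u v h x = J u (incl (hO.bdryNoise_anti h) (R v x)) :=
    fun _ _ _ _ => rfl
  have hnormal : ∀ u v h, IsWStarHom (γ u v h) := fun u v h =>
    (hRJ u).normal_inj.comp ((isWStarHom_incl _).comp (hRJ v).normal)
  clear_value γ
  have hREt : ∀ t Δ, R t (Et t Δ) = P t Δ := fun t Δ => by rw [hEt, (hRJ t).rep_inj]
  have hRγ : ∀ u v h x, R u (γ u v h x) = incl (hO.bdryNoise_anti h) (R v x) :=
    fun u v h x => by
    rw [hγ, (hRJ u).rep_inj]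
  have hincr : ∀ {u v Δ}, MeasurableSet[S.incr u v] Δ → MeasurableSet[S.fut u] Δ :=
    fun hΔ => (MeasurableSpace.measurableSet_inf.mp hΔ).1
  have hσ : ∀ t, IsSigmaHom (S.fut t)
      fun Δ => (Et t Δ : HTensor (K t) H →L[ℂ] HTensor (K t) H) := fun t =>
    (hRJ t).normal_inj.isSigmaHom (S.sigmaHom.mono (S.fut_le t)) (hP t) fun Δ _ => hEt t Δ
  have hEinter : ∀ t Δ Γ, MeasurableSet[S.fut t] Δ → MeasurableSet[S.fut t] Γ →
      Et t (Δ ∩ Γ) = Et t Δ * Et t Γ := fun t Δ Γ hΔ hΓ => Subtype.ext ((hσ t).inter Δ Γ hΔ hΓ)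
  have hEadapted : ∀ t v, t < v → ∀ Δ, MeasurableSet[S.incr t v] Δ →
      (Et t Δ : HTensor (K t) H →L[ℂ] HTensor (K t) H) ∈ O.extIncr t v := fun t v h Δ hΔ => by
    rw [hEt]
    exact (hRJ t).inj_mem_extIncr v _ (by rw [hP t Δ (hincr hΔ)]; exact hO.E_incr_mem h hΔ)
  have hγadapted : ∀ u v (h : u < v) (q : Elt (O.b v)),
      (γ u v h.le (inl (O.b v) (S.A v) q) : HTensor (K u) H →L[ℂ] HTensor (K u) H)
        ∈ O.extIncr u v := fun u v h q => by
    rw [hγ]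
    exact (hRJ u).inj_mem_extIncr v _ (by
      rw [coe_incl, (hRJ v).apply_inl]
      exact hO u v h (le_vnSup_right _ _ (O.rep v q).2))
  have hcausal : ∀ u v (h : u < v) (x : Elt (O.ext v)) (Δ), MeasurableSet[S.incr u v] Δ →
      Et u Δ * γ u v h.le x = γ u v h.le x * Et u Δ := by
    intro u v h x Δ hΔ
    rw [hγ, hEt]
    -- Events before `v` commute with `S.Bfut v` on `H`, and `J u` transports the commutation.
    refine map_commute_of_coe (J u) ?_
    rw [coe_incl, hP u Δ (hincr hΔ)]
    exact S.causal v Δ (MeasurableSpace.measurableSet_inf.mp hΔ).2 _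
      (O.bdryNoise_le_Bfut v (R v x).2)
  have hhemi : ∀ u v w (h : u ≤ v) (h' : v ≤ w) (x : Elt (O.ext w)),
      γ u v h (γ v w h' x) = γ u w (h.trans h') x := fun u v w h h' x => by
    -- The middle pair `R v`, `J v` cancels, leaving a composite of inclusions.
    rw [hγ u v, hRγ, hγ u w, incl_incl]
  have hγE : ∀ u v (h : u ≤ v) (Δ), MeasurableSet[S.fut v] Δ → γ u v h (Et v Δ) = Et u Δ := by
    intro u v h Δ hΔ
    rw [hγ, hREt, hEt]
    refine congrArg (J u) (Subtype.ext ?_)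
    rw [coe_incl, hP v Δ hΔ, hP u Δ (S.fut_anti h _ hΔ)]
  refine ⟨R, Et, γ, ⟨fun t => (hRJ t).normal, fun t q => congrArg Subtype.val ((hRJ t).apply_inl q),
    fun t a => congrArg Subtype.val ((hRJ t).apply_inr a)⟩, ⟨hσ, hEadapted⟩,
    ⟨hnormal, hγadapted, fun u v h a => ?_, hcausal, hhemi⟩, fun t hs x => by
      rw [hγ, incl_self, (hRJ t).inj_rep hs],
    hγE, fun t Δ hΔ => by rw [hREt, hP t Δ hΔ], fun u v h x => by
      rw [hRγ, coe_incl],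
    fun u v h => ?_, fun u v w h h' Δ Γ hΔ hΓ => ⟨S.incr_inter h.le h'.le hΔ hΓ, fun x => ?_⟩⟩
  · rw [hγ, (hRJ v).apply_inr]
    exact congrArg Subtype.val ((hRJ u).inj_right (incl (S.A_anti h) a))
  · have hσ' : IsSigmaHom (S.incr u v)
        fun Δ => (Et u Δ : HTensor (K u) H →L[ℂ] HTensor (K u) H) := (hσ u).mono inf_le_left
    exact isSpectralTransferMeasure_mul hσ'
      (f := (γ u v h.le).comp (inlHom (O.b v) (S.A v)))
      ((hnormal u v h.le).comp (isNormalMap_inl (O.b v) (S.A v)))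
      (fun q Δ hΔ => hcausal u v h _ Δ hΔ) (hEadapted u v h) (hγadapted u v h)
  · have hΓ' : MeasurableSet[S.fut u] Γ := S.fut_anti h.le _ (hincr hΓ)
    simp only [OpenObject.transition]
    -- The flow carries the event `Γ` from time `v` to time `u`, where the two projections multiply
    -- to that of the intersection.
    rw [mul_map_mul, hγE u v h.le Γ (hincr hΓ), hhemi, hEinter u Δ Γ (hincr hΔ) hΓ']
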